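/- \textbf{Definitions.} For a graph $G$ and finite disjoint vertex sets $A,B$ let $E(A,B)$ be the set of edges of $G$ between $A$ and $B$, and $d(A,B)=|E(A,B)|/(|A||B|)$. The pair $(A,B)$ is $\varepsilon$-regular if $|d(A',B')-d(A,B)|\le\varepsilon\, d(A,B)$ for all $A'\subseteq A$, $B'\subseteq B$ with $|A'|\ge\varepsilon|A|$, $|B'|\ge\varepsilon|B|$; it is $(\varepsilon,q)$-lower-regular if $d(A',B')\ge(1-\varepsilon)q$ for all such nonempty $A',B'$. Let $P_\ell^2$ be the square of the path of length $\ell$: its vertices are $1,\dots,\ell+1$, and $i\ne j$ are adjacent iff $|i-j|\le 2$. Let $\tilde{\mathcal G}(P_\ell^2,m,q,\varepsilon)$ be the class of graphs with pairwise disjoint vertex sets $V_1,\dots,V_{\ell+1}$ of size $m$ such that for all $i,j$ with $1\le|i-j|\le2$ the pair $(V_i,V_j)$ is $\varepsilon$-regular with $(1-\varepsilon)q\le d(V_i,V_j)\le(1+\varepsilon)q$, and such that for every $i\in\{1,\dots,\ell-1\}$: (i) every edge between $V_i$ and $V_{i+1}$ closes a triangle with at least $(1-\varepsilon)mq^2$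 vertices of $V_{i+2}$; and (ii) for all but at most $\varepsilon m$ vertices $v\in V_{i+1}$ the neighbourhoods of $v$ in $V_i$ and in $V_{i+2}$ form an $(\varepsilon,q)$-lower-regular pair. An edge $e=v_1v_2$ with $v_1\in V_1$, $v_2\in V_2$ \emph{expands} to a set $E'\subseteq E(V_\ell,V_{\ell+1})$ if for every $e'\in E'$ there are vertices $v_j\in V_j$ for $3\le j\le\ell+1$ with $e'=v_\ell v_{\ell+1}$ such that $v_iv_j$ is an edge of $G$ whenever $1\le|i-j|\le2$ (that is, $v_1,\dots,v_{\ell+1}$ is the square of a path of length $\ell$ in $G$ from $e$ to $e'$). \textbf{Statement.} For every $\alpha>0$ there is $\varepsilon_0=\varepsilon_0(\alpha)>0$ such that for all $0<\varepsilon\le\varepsilon_0$, all $\eta>0$, all $0<\gamma\le1$ and all integers $k\ge 3/\gamma$ the following holds. Let $p=p(n)=n^{-1/2+\gamma/2}$. With probability tending to $1$ as $n\to\infty$, the random graph $G_{n,p}$ has this property: for every subgraph $G\subseteq G_{n,p}$ that belongs to $\tilde{\mathcal G}(P^2_{k+4},n_0,\alpha p,\varepsilon)$, with vertex sets $V_1,\dots,V_{k+5}$,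 for some $n_0\ge\eta n$, every edge of $G$ between $V_1$ and $V_2$ expands to a set of at least $0.52\cdot|E(V_{k+4},V_{k+5})|$ edges of $E(V_{k+4},V_{k+5})$. -/

import Mathlib

namespace PathExpansion

/-- The square `P_k²` of the path of length `k`: the vertices are `0, …, k`, and two distinct
vertices are adjacent when they are at distance at most two along the path. -/
def pathSquare (k : ℕ) : SimpleGraph (Fin (k + 1)) where
  Adj i j := i ≠ j ∧ (i : ℕ) ≤ j + 2 ∧ (j : ℕ) ≤ i + 2
  symm := ⟨fun _ _ h => ⟨h.1.symm, h.2.2, h.2.1⟩⟩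
  loopless := ⟨fun _ h => h.1 rfl⟩

variable {W : Type*}

open scoped Classical in
/-- `E(A, B)`, each edge being recorded as the pair (endpoint in `A`, endpoint in `B`). For disjoint
`A` and `B` this counts every edge once. -/
noncomputable def edgesBetween (G : SimpleGraph W) (A B : Finset W) : Finset (W × W) :=
  G.interedges A B

/-- `|E(A, B)| / (|A| |B|)`. -/
noncomputable def density (G : SimpleGraph W) (A B : Finset W) : ℝ :=
  ((edgesBetween G A B).card : ℝ) / ((A.card : ℝ) * (B.card : ℝ))

/-- `(ε, q)`-regularity of the bipartite graph between `A` and `B`. -/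
def IsRegularWith (G : SimpleGraph W) (ε q : ℝ) (A B : Finset W) : Prop :=
  ∀ A' ⊆ A, ∀ B' ⊆ B, ε * (A.card : ℝ) ≤ A'.card → ε * (B.card : ℝ) ≤ B'.card →
    |density G A' B' - density G A B| ≤ ε * q

/-- `ε`-regularity: `(ε, q)`-regularity where `q` is the density of the pair. -/
def IsRegular (G : SimpleGraph W) (ε : ℝ) (A B : Finset W) : Prop :=
  IsRegularWith G ε (density G A B) A B

/-- `(ε, q)`-lower-regularity of the bipartite graph between `A` and `B`. The test sets are required
to be nonempty so that the quotient in `density` makes sense. -/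
def IsLowerRegular (G : SimpleGraph W) (ε q : ℝ) (A B : Finset W) : Prop :=
  ∀ A' ⊆ A, ∀ B' ⊆ B, A'.Nonempty → B'.Nonempty →
    ε * (A.card : ℝ) ≤ A'.card → ε * (B.card : ℝ) ≤ B'.card →
    (1 - ε) * q ≤ density G A' B'

/-- `G`, with the vertex sets `V i`, belongs to the class `𝒢(F, m, q, ε)` of regular blow-ups
of `F`. -/
structure IsBlowUp {ι : Type*} (F : SimpleGraph ι) (G : SimpleGraph W) (V : ι → Finset W)
    (m : ℕ) (q ε : ℝ) : Prop where
  card_eq : ∀ i, (V i).card = m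
  disjoint : ∀ i j, i ≠ j → Disjoint (V i) (V j)
  regular : ∀ i j, F.Adj i j → IsRegular G ε (V i) (V j)
  density_ge : ∀ i j, F.Adj i j → (1 - ε) * q ≤ density G (V i) (V j)
  density_le : ∀ i j, F.Adj i j → density G (V i) (V j) ≤ (1 + ε) * q

open scoped Classical in
/-- The neighbours of `v` in `A`. -/
noncomputable def nbhdIn (G : SimpleGraph W) (v : W) (A : Finset W) : Finset W :=
  A.filter (fun x => G.Adj v x)

open scoped Classical in
/-- `G`, with the vertex sets `V 0, …, V k`, belongs to the class `𝒢̃(P_k², m, q, ε)`. -/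
structure IsTildeBlowUp (k : ℕ) (G : SimpleGraph W) (V : Fin (k + 1) → Finset W)
    (m : ℕ) (q ε : ℝ) : Prop extends IsBlowUp (pathSquare k) G V m q ε where
  /-- Every edge between `V i` and `V (i+1)` closes a triangle with at least `(1 - ε) m q²`
  vertices of `V (i+2)`. -/
  triangles : ∀ (i : ℕ) (hi : i + 2 < k + 1),
    ∀ u ∈ V ⟨i, by omega⟩, ∀ w ∈ V ⟨i + 1, by omega⟩, G.Adj u w →
      (1 - ε) * (m : ℝ) * q ^ 2 ≤
        (((V ⟨i + 2, hi⟩).filter (fun x => G.Adj u x ∧ G.Adj w x)).card : ℝ)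
  /-- All but at most `ε m` vertices of `V (i+1)` have neighbourhoods into `V i` and `V (i+2)`
  that induce an `(ε, q)`-lower-regular graph. -/
  lowerRegular : ∀ (i : ℕ) (hi : i + 2 < k + 1),
    (((V ⟨i + 1, by omega⟩).filter (fun v =>
      ¬ IsLowerRegular G ε q (nbhdIn G v (V ⟨i, by omega⟩))
        (nbhdIn G v (V ⟨i + 2, hi⟩)))).card : ℝ) ≤ ε * (m : ℝ)

/-- The edge `e` between `V 0` and `V 1` expands to the set `E'` of edges between `V k` and
`V (k+1)`: for every `e' ∈ E'` some copy in `G` of the square of the path of length `k + 1`, with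
its `j`-th vertex in `V j`, starts with the edge `e` and ends with the edge `e'`. -/
def Expands {k : ℕ} (G : SimpleGraph W) (V : Fin (k + 2) → Finset W) (e : W × W)
    (E' : Finset (W × W)) : Prop :=
  ∀ e' ∈ E', ∃ f : (pathSquare (k + 1)).Copy G, (∀ j, f j ∈ V j) ∧
    e = (f 0, f 1) ∧ e' = (f (Fin.last k).castSucc, f (Fin.last (k + 1)))

end PathExpansion

/-!
Fix an edge `e` and follow, one vertex at a time, the set of edges that end the square of a path
starting with `e`. An edge `u v` of this set extends along each of the about `p²n` triangles on it,
so without collisions the set is multiplied by about `p²n = n^γ` in every step. The only input from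
the random graph is that between disjoint sets `A` and `B` the number of edges is at most
`2p|A||B| + D(|A| + |B|)` with `D` a small power of `n`.

Let `d` be the number of triangles on every edge. If `x` in-neighbours of `v` are reached and lead
on to `y` out-neighbours, then there are at least `d x` edges between these two sets, hence
`d x ≤ 2p x y + D(x + y)`. Therefore `y` is at least about `x d / D²` as long as `v` is unsaturated,
that is, `p x ≤ D²`, and `y` is at least about `d / p`, a positive proportion of the degree of `v`,
when `v` is saturated. So either unsaturated vertices carry half of the reached edges
and the set grows; or there are few saturated vertices, so that their out-neighbourhoods hardly
overlap and the set grows in the following step; or there are so many of them that they lead to a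
positive proportion of saturated vertices in the following step. Growth by `p²n / D³` in every one
or two steps cannot last for `k ≥ 3 / γ` steps, so that a positive proportion of the vertices of
some `V_j` ends up with a positive proportion of its possible out-neighbours.

From there on, regularity takes over. By lower regularity of the neighbourhoods, almost every vertex
with more than a proportion `ε` of its in-neighbours reached has almost all its out-neighbours
reached, and by regularity of the pairs almost all vertices are of this kind one step later.
-/

namespace PathExpansion

open MeasureTheory Filter Topology
open scoped ENNReal Finset unitInterval Classical

/-! ### Counting pairs of a relation -/

section Counting

variable {X Y ι : Type*} {S S' : X → Y → Prop} {A A' : Finset X} {B B' : Finset Y}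

lemma card_interedges_eq_sum_bipartiteAbove (S : X → Y → Prop) (A : Finset X) (B : Finset Y) :
    (#(Rel.interedges S A B) : ℝ) = ∑ u ∈ A, (#(B.bipartiteAbove S u) : ℝ) := by
  simp only [Rel.interedges, Finset.bipartiteAbove, Finset.card_filter, Finset.sum_product]
  push_cast
  rfl

lemma card_interedges_eq_sum_bipartiteBelow (S : X → Y → Prop) (A : Finset X) (B : Finset Y) :
    (#(Rel.interedges S A B) : ℝ) = ∑ v ∈ B, (#(A.bipartiteBelow S v) : ℝ) := by
  rw [card_interedges_eq_sum_bipartiteAbove]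
  exact_mod_cast Finset.sum_card_bipartiteAbove_eq_sum_card_bipartiteBelow S

lemma card_interedges_mono (hA : A ⊆ A') (hB : B ⊆ B') (h : S ≤ S') :
    (#(Rel.interedges S A B) : ℝ) ≤ #(Rel.interedges S' A' B') := by
  refine Nat.cast_le.2 (Finset.card_le_card fun e he => ?_)
  rw [Rel.mem_interedges_iff] at he ⊢
  exact ⟨hA he.1, hB he.2.1, h _ _ he.2.2⟩

lemma sum_le_sum_filter_lt_add (s : Finset ι) (f : ι → ℝ) {θ : ℝ} (hθ : 0 ≤ θ) :
    ∑ i ∈ s, f i ≤ ∑ i ∈ s with θ < f i, f i + #s * θ := by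
  rw [← Finset.sum_filter_add_sum_filter_not s (θ < f ·), ← nsmul_eq_mul]
  gcongr
  refine (Finset.sum_le_card_nsmul _ _ θ fun i hi => not_lt.1 (Finset.mem_filter.1 hi).2).trans ?_
  exact nsmul_le_nsmul_left hθ (Finset.card_filter_le _ _)

end Counting

variable {W : Type*}

lemma mem_edgesBetween {G : SimpleGraph W} {A B : Finset W} {e : W × W} :
    e ∈ edgesBetween G A B ↔ e.1 ∈ A ∧ e.2 ∈ B ∧ G.Adj e.1 e.2 :=
  Rel.mem_interedges_iff

lemma edgesBetween_mono {G H : SimpleGraph W} {A A' B B' : Finset W} (hGH : G ≤ H) (hA : A ⊆ A')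
    (hB : B ⊆ B') : edgesBetween G A B ⊆ edgesBetween H A' B' := fun e he => by
  rw [mem_edgesBetween] at he ⊢
  exact ⟨hA he.1, hB he.2.1, hGH he.2.2⟩

lemma card_edgesBetween_singleton_left (G : SimpleGraph W) (v : W) (B : Finset W) :
    #(edgesBetween G {v} B) = #(nbhdIn G v B) := by
  have h := card_interedges_eq_sum_bipartiteAbove G.Adj {v} B
  rw [Finset.sum_singleton] at h
  exact_mod_cast h

/-! ### Edge counts in the binomial random graph -/

section RandomGraph

lemma measurableSet_forall_adj (J : Finset (W × W)) :
    MeasurableSet {H : SimpleGraph W | ∀ e ∈ J, H.Adj e.1 e.2} := by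
  have hinter : {H : SimpleGraph W | ∀ e ∈ J, H.Adj e.1 e.2} =
      ⋂ e ∈ J, {H : SimpleGraph W | H.Adj e.1 e.2} := by
    ext; simp
  rw [hinter]
  exact Finset.measurableSet_biInter _ fun e _ => measurableSet_setOfPred.2 (by fun_prop)

lemma two_pow_card_edgesBetween (H : SimpleGraph W) (A B : Finset W) :
    (2 : ℝ≥0∞) ^ #(edgesBetween H A B) = ∑ J ∈ (A ×ˢ B).powerset,
      Set.indicator {H : SimpleGraph W | ∀ e ∈ J, H.Adj e.1 e.2} 1 H := by
  have hpowerset : {J ∈ (A ×ˢ B).powerset | ∀ e ∈ J, H.Adj e.1 e.2} =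
      (edgesBetween H A B).powerset := by
    ext J
    simp only [Finset.mem_filter, Finset.mem_powerset, Finset.subset_iff, Finset.mem_product,
      mem_edgesBetween]
    grind
  simp only [Set.indicator_apply, Set.mem_ofPred_eq, Pi.one_apply, Finset.sum_boole, hpowerset,
    Finset.card_powerset]
  norm_num

lemma measurable_two_pow_card_edgesBetween (A B : Finset W) :
    Measurable fun H : SimpleGraph W => (2 : ℝ≥0∞) ^ #(edgesBetween H A B) := by
  simp only [two_pow_card_edgesBetween]
  exact Finset.measurable_sum _ fun J _ => measurable_one.indicator (measurableSet_forall_adj J)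

section Countable

variable [Countable W] (p : I) {A B : Finset W}

lemma binomialRandom_forall_adj_le (J : Finset (W × W))
    (hJ : Set.InjOn (fun e : W × W => s(e.1, e.2)) J) :
    SimpleGraph.binomialRandom W p {H | ∀ e ∈ J, H.Adj e.1 e.2} ≤ ENNReal.ofReal p ^ #J := by
  rw [SimpleGraph.binomialRandom_apply]
  have hsub : (fun (G : SimpleGraph W) (e : Sym2 W) => e ∈ G.edgeSet) ''
      {H | ∀ e ∈ J, H.Adj e.1 e.2} ⊆
      ((J.image (fun e : W × W => s(e.1, e.2)) : Finset (Sym2 W)) : Set (Sym2 W)).pi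
        (fun _ => ({True} : Set Prop)) := by
    rintro _ ⟨H, hH, rfl⟩ e he
    simp only [Finset.coe_image, Set.mem_image, Finset.mem_coe] at he
    obtain ⟨x, hx, rfl⟩ := he
    simpa using hH x hx
  refine (measure_mono hsub).trans ?_
  rw [Measure.infinitePi_pi _ (fun _ _ => MeasurableSet.of_discrete),
    ← Finset.card_image_of_injOn hJ]
  refine Finset.prod_le_pow_card _ _ _ fun e _ => ?_
  have hp : (unitInterval.toNNReal p : ℝ≥0∞) = ENNReal.ofReal (p : ℝ) := by
    rw [ENNReal.ofReal, Real.toNNReal_of_nonneg p.2.1]; rfl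
  simp only [Measure.coe_add, Measure.coe_nnreal_smul_apply, Pi.add_apply, hp,
    Measure.dirac_apply' _ MeasurableSet.of_discrete]
  by_cases h : e.IsDiag <;> simp [h]

lemma lintegral_two_pow_card_edgesBetween_le (hAB : Disjoint A B) :
    ∫⁻ H, 2 ^ #(edgesBetween H A B) ∂SimpleGraph.binomialRandom W p ≤
      ENNReal.ofReal ((p + 1) ^ (#A * #B)) := by
  have hinj : Set.InjOn (fun e : W × W => s(e.1, e.2)) (A ×ˢ B : Finset (W × W)) := by
    rintro ⟨a, b⟩ h ⟨a', b'⟩ h' he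
    simp only [Finset.coe_product, Set.mem_prod, Finset.mem_coe] at h h'
    rcases Sym2.eq_iff.1 he with ⟨rfl, rfl⟩ | ⟨rfl, rfl⟩
    · rfl
    · exact absurd h'.2 (Finset.disjoint_left.1 hAB h.1)
  calc ∫⁻ H, 2 ^ #(edgesBetween H A B) ∂SimpleGraph.binomialRandom W p
      = ∑ J ∈ (A ×ˢ B).powerset,
          SimpleGraph.binomialRandom W p {H : SimpleGraph W | ∀ e ∈ J, H.Adj e.1 e.2} := by
        simp only [two_pow_card_edgesBetween]
        rw [lintegral_finsetSum _ fun J _ => measurable_one.indicator (measurableSet_forall_adj J)]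
        exact Finset.sum_congr rfl fun J _ => lintegral_indicator_one (measurableSet_forall_adj J)
    _ ≤ ∑ J ∈ (A ×ˢ B).powerset, ENNReal.ofReal p ^ #J :=
        Finset.sum_le_sum fun J hJ => binomialRandom_forall_adj_le p J <|
          hinj.mono (by exact_mod_cast Finset.mem_powerset.1 hJ)
    _ = (ENNReal.ofReal p + 1) ^ #(A ×ˢ B) := by
        rw [← Finset.sum_pow_mul_eq_add_pow]; simp
    _ = ENNReal.ofReal ((p + 1) ^ (#A * #B)) := by
        rw [ENNReal.ofReal_pow (by linarith [p.2.1]), ENNReal.ofReal_add p.2.1 zero_le_one,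
          Finset.card_product, ENNReal.ofReal_one]

lemma add_one_le_two_rpow_two_mul {x : ℝ} (hx : 0 ≤ x) : x + 1 ≤ (2 : ℝ) ^ (2 * x) := by
  refine (Real.add_one_le_exp x).trans ?_
  rw [Real.rpow_def_of_pos two_pos, Real.exp_le_exp]
  nlinarith [Real.log_two_gt_d9]

/-- Markov's inequality for `2 ^ e(A, B)`. -/
lemma binomialRandom_lt_card_edgesBetween_le (hAB : Disjoint A B) (y : ℝ) :
    SimpleGraph.binomialRandom W p {H | 2 * (p : ℝ) * (#A * #B) + y < #(edgesBetween H A B)} ≤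
      ENNReal.ofReal (2 ^ (-y)) := by
  set μ := SimpleGraph.binomialRandom W p
  set x : ℝ := 2 * (p : ℝ) * (#A * #B)
  have hmean : ∫⁻ H, 2 ^ #(edgesBetween H A B) ∂μ ≤ ENNReal.ofReal (2 ^ x) := by
    refine (lintegral_two_pow_card_edgesBetween_le p hAB).trans (ENNReal.ofReal_le_ofReal ?_)
    calc ((p : ℝ) + 1) ^ (#A * #B) ≤ ((2 : ℝ) ^ (2 * (p : ℝ))) ^ (#A * #B) :=
          pow_le_pow_left₀ (by linarith [p.2.1]) (add_one_le_two_rpow_two_mul p.2.1) _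
      _ = 2 ^ x := by
          rw [← Real.rpow_natCast, ← Real.rpow_mul two_pos.le]; push_cast; rfl
  have hsub : {H | x + y < #(edgesBetween H A B)} ⊆
      {H | ENNReal.ofReal (2 ^ (x + y)) ≤ 2 ^ #(edgesBetween H A B)} := by
    intro H (hH : x + y < #(edgesBetween H A B))
    calc ENNReal.ofReal (2 ^ (x + y)) ≤ ENNReal.ofReal (2 ^ (#(edgesBetween H A B) : ℝ)) :=
          ENNReal.ofReal_le_ofReal (Real.rpow_le_rpow_of_exponent_le one_le_two hH.le)
      _ = 2 ^ #(edgesBetween H A B) := by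
          rw [Real.rpow_natCast, ENNReal.ofReal_pow two_pos.le]; norm_num
  have hpos : (0 : ℝ) < 2 ^ (x + y) := Real.rpow_pos_of_pos two_pos _
  have hscaled : ENNReal.ofReal (2 ^ (x + y)) * μ {H | x + y < #(edgesBetween H A B)} ≤
      ENNReal.ofReal (2 ^ (x + y)) * ENNReal.ofReal (2 ^ (-y)) := by
    rw [← ENNReal.ofReal_mul hpos.le, ← Real.rpow_add two_pos, add_neg_cancel_right]
    exact (mul_le_mul_right (measure_mono hsub) _).trans <|
      (mul_meas_ge_le_lintegral (measurable_two_pow_card_edgesBetween A B) _).trans hmean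
  exact (ENNReal.mul_le_mul_iff_right (by simpa using hpos) ENNReal.ofReal_ne_top).1 hscaled

end Countable

section Fintype

variable [Fintype W]

/-- The pseudorandomness of `G(n, p)` that the argument uses: edge counts between disjoint sets and
degrees exceed twice their mean by at most an error that `D` controls. -/
structure EdgeBounded (H : SimpleGraph W) (p D : ℝ) : Prop where
  card_edges_le : ∀ A B : Finset W, Disjoint A B →
    (#(edgesBetween H A B) : ℝ) ≤ 2 * p * (#A * #B) + D * (#A + #B)
  degree_le : ∀ v : W, (H.degree v : ℝ) ≤ 2 * p * Fintype.card W + D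

lemma EdgeBounded.mono {G H : SimpleGraph W} {p D : ℝ} (hH : EdgeBounded H p D) (hGH : G ≤ H) :
    EdgeBounded G p D where
  card_edges_le A B hAB := (Nat.cast_le.2 <| Finset.card_le_card <|
    edgesBetween_mono hGH subset_rfl subset_rfl).trans (hH.card_edges_le A B hAB)
  degree_le v := (Nat.cast_le.2 <| SimpleGraph.degree_le_of_le hGH).trans (hH.degree_le v)

lemma card_edgesBetween_singleton_univ_erase (H : SimpleGraph W) (v : W) :
    #(edgesBetween H {v} (Finset.univ.erase v)) = H.degree v := by
  rw [card_edgesBetween_singleton_left, ← SimpleGraph.card_neighborFinset_eq_degree]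
  congr 1
  ext u
  simpa [nbhdIn] using fun h : H.Adj v u => h.ne'

lemma sum_pow_card_erase_empty (x : ℝ) :
    ∑ A ∈ (Finset.univ : Finset (Finset W)).erase ∅, x ^ #A = (1 + x) ^ Fintype.card W - 1 := by
  rw [← Finset.card_univ, add_comm 1 x, ← Finset.sum_pow_mul_eq_add_pow, Finset.powerset_univ,
    ← Finset.add_sum_erase _ _ (Finset.mem_univ ∅)]
  simp

lemma binomialRandom_exists_lt_card_edgesBetween_le (p : I) (D : ℝ) :
    SimpleGraph.binomialRandom W p {H | ∃ A B : Finset W, A.Nonempty ∧ B.Nonempty ∧ Disjoint A B ∧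
        2 * (p : ℝ) * (#A * #B) + D * (#A + #B) < #(edgesBetween H A B)} ≤
      ENNReal.ofReal (((1 + 2 ^ (-D)) ^ Fintype.card W - 1) ^ 2) := by
  set μ := SimpleGraph.binomialRandom W p
  set x : ℝ := 2 ^ (-D) with hx
  set N : Finset (Finset W) := Finset.univ.erase ∅ with hN
  have hsub : {H | ∃ A B : Finset W, A.Nonempty ∧ B.Nonempty ∧ Disjoint A B ∧
        2 * (p : ℝ) * (#A * #B) + D * (#A + #B) < #(edgesBetween H A B)} ⊆
      ⋃ P ∈ {P ∈ N ×ˢ N | Disjoint P.1 P.2},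
        {H | 2 * (p : ℝ) * (#P.1 * #P.2) + D * (#P.1 + #P.2) < #(edgesBetween H P.1 P.2)} := by
    rintro H ⟨A, B, hA, hB, hAB, hH⟩
    exact Set.mem_biUnion (x := (A, B)) (by simp [hN, hA.ne_empty, hB.ne_empty, hAB]) hH
  calc _ ≤ ∑ P ∈ N ×ˢ N with Disjoint P.1 P.2,
        μ {H | 2 * (p : ℝ) * (#P.1 * #P.2) + D * (#P.1 + #P.2) < #(edgesBetween H P.1 P.2)} :=
        (measure_mono hsub).trans (measure_biUnion_finset_le _ _)
    _ ≤ ∑ P ∈ N ×ˢ N with Disjoint P.1 P.2, ENNReal.ofReal (x ^ #P.1 * x ^ #P.2) := by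
        refine Finset.sum_le_sum fun P hP =>
          (binomialRandom_lt_card_edgesBetween_le p (Finset.mem_filter.1 hP).2 _).trans_eq ?_
        rw [hx, ← pow_add, ← Real.rpow_natCast, ← Real.rpow_mul two_pos.le]
        push_cast
        ring_nf
    _ ≤ ∑ P ∈ N ×ˢ N, ENNReal.ofReal (x ^ #P.1 * x ^ #P.2) :=
        Finset.sum_le_sum_of_subset (Finset.filter_subset _ _)
    _ = ENNReal.ofReal (((1 + x) ^ Fintype.card W - 1) ^ 2) := by
        rw [← ENNReal.ofReal_sum_of_nonneg fun _ _ => by positivity, Finset.sum_product,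
          sq, ← sum_pow_card_erase_empty, Finset.sum_mul_sum]

lemma binomialRandom_exists_lt_degree_le (p : I) (D : ℝ) :
    SimpleGraph.binomialRandom W p {H | ∃ v, 2 * (p : ℝ) * Fintype.card W + D < H.degree v} ≤
      ENNReal.ofReal (Fintype.card W * 2 ^ (-D)) := by
  set μ := SimpleGraph.binomialRandom W p
  have hvertex : ∀ v : W, μ {H | 2 * (p : ℝ) * Fintype.card W + D < H.degree v} ≤
      ENNReal.ofReal (2 ^ (-D)) := fun v => by
    refine (measure_mono fun H hH => ?_).trans
      (binomialRandom_lt_card_edgesBetween_le p (A := {v}) (B := Finset.univ.erase v) (by simp) D)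
    have hp := p.2.1
    calc _ ≤ 2 * (p : ℝ) * Fintype.card W + D := by gcongr; simp
      _ < H.degree v := hH
      _ = _ := by rw [card_edgesBetween_singleton_univ_erase]
  calc _ = μ (⋃ v, {H | 2 * (p : ℝ) * Fintype.card W + D < H.degree v}) := by
        congr 1; ext; simp
    _ ≤ ∑ v : W, μ {H | 2 * (p : ℝ) * Fintype.card W + D < H.degree v} :=
        measure_iUnion_fintype_le _ _
    _ ≤ ∑ _v : W, ENNReal.ofReal (2 ^ (-D)) := Finset.sum_le_sum fun v _ => hvertex v
    _ = ENNReal.ofReal (Fintype.card W * 2 ^ (-D)) := by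
        rw [Finset.sum_const, Finset.card_univ, nsmul_eq_mul,
          ENNReal.ofReal_mul (by positivity), ENNReal.ofReal_natCast]

lemma binomialRandom_not_edgeBounded_le (p : I) {D : ℝ} (hD : 0 ≤ D) :
    SimpleGraph.binomialRandom W p {H | ¬ EdgeBounded H p D} ≤
      ENNReal.ofReal (((1 + 2 ^ (-D)) ^ Fintype.card W - 1) ^ 2 + Fintype.card W * 2 ^ (-D)) := by
  rw [ENNReal.ofReal_add (by positivity) (by positivity)]
  refine (measure_mono fun H hH => ?_).trans <| (measure_union_le _ _).trans <| add_le_add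
    (binomialRandom_exists_lt_card_edgesBetween_le p D) (binomialRandom_exists_lt_degree_le p D)
  by_contra hgood
  simp only [Set.mem_union, Set.mem_ofPred_eq, not_or, not_exists, not_and, not_lt] at hgood
  refine hH ⟨fun A B hAB => ?_, hgood.2⟩
  rcases A.eq_empty_or_nonempty with rfl | hA
  · simpa [edgesBetween, SimpleGraph.interedges] using by positivity
  rcases B.eq_empty_or_nonempty with rfl | hB
  · simpa [edgesBetween, SimpleGraph.interedges, Rel.interedges] using by positivity
  exact hgood.1 A B hA hB hAB

end Fintype

lemma tendsto_natCast_mul_two_rpow_neg_rpow {δ : ℝ} (hδ : 0 < δ) :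
    Tendsto (fun n : ℕ => (n : ℝ) * 2 ^ (-(n : ℝ) ^ δ)) atTop (𝓝 0) := by
  have hexp : Tendsto (fun y : ℝ => y ^ (1 / δ) * Real.exp (-Real.log 2 * y)) atTop (𝓝 0) :=
    tendsto_rpow_mul_exp_neg_mul_atTop_nhds_zero _ _ (Real.log_pos one_lt_two)
  refine (hexp.comp ((tendsto_rpow_atTop hδ).comp tendsto_natCast_atTop_atTop)).congr fun n => ?_
  simp only [Function.comp_apply]
  rw [← Real.rpow_mul n.cast_nonneg, mul_one_div_cancel hδ.ne', Real.rpow_one,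
    Real.rpow_def_of_pos two_pos]
  ring_nf

theorem tendsto_binomialRandom_not_edgeBounded (p : ℕ → I) {δ : ℝ} (hδ : 0 < δ) :
    Tendsto (fun n => SimpleGraph.binomialRandom (Fin n) (p n)
      {H | ¬ EdgeBounded H (p n) ((n : ℝ) ^ δ)}) atTop (𝓝 0) := by
  have hlin := tendsto_natCast_mul_two_rpow_neg_rpow hδ
  have hpow := Real.tendsto_one_add_pow_exp_of_tendsto hlin
  have hbound := ENNReal.tendsto_ofReal (((hpow.sub_const 1).pow 2).add hlin)
  refine tendsto_of_tendsto_of_tendsto_of_le_of_le tendsto_const_nhds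
    (by simpa using hbound) (fun _ => zero_le) fun n => ?_
  simpa using binomialRandom_not_edgeBounded_le (W := Fin n) (p n)
    (Real.rpow_nonneg n.cast_nonneg δ)

theorem tendsto_binomialRandom_of_edgeBounded (p : ℕ → I) {δ : ℝ} (hδ : 0 < δ)
    {E : (n : ℕ) → Set (SimpleGraph (Fin n))}
    (hE : ∀ᶠ n : ℕ in atTop, ∀ H, EdgeBounded H (p n) ((n : ℝ) ^ δ) → H ∈ E n) :
    Tendsto (fun n => SimpleGraph.binomialRandom (Fin n) (p n) (E n)) atTop (𝓝 1) := by
  have hlow : Tendsto (fun n => 1 - SimpleGraph.binomialRandom (Fin n) (p n)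
      {H | ¬ EdgeBounded H (p n) ((n : ℝ) ^ δ)}) atTop (𝓝 1) := by
    simpa using ENNReal.Tendsto.sub tendsto_const_nhds
      (tendsto_binomialRandom_not_edgeBounded p hδ) (Or.inl ENNReal.one_ne_top)
  refine tendsto_of_tendsto_of_tendsto_of_le_of_le' hlow tendsto_const_nhds ?_
    (Eventually.of_forall fun n => prob_le_one)
  filter_upwards [hE] with n hn
  rw [tsub_le_iff_right, ← measure_univ (μ := SimpleGraph.binomialRandom (Fin n) (p n))]
  refine (measure_mono fun H _ => ?_).trans (measure_union_le _ _)
  exact (em (EdgeBounded H (p n) ((n : ℝ) ^ δ))).imp (hn H) id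

end RandomGraph

/-! ### One step along the square of a path -/

variable {G : SimpleGraph W} {A A' B C T : Finset W} {S : W → W → Prop} {p D d L b : ℝ}

/-- The pairs `(v, w)` that extend some pair `(u, v)` of `S` with `u ∈ A` to a triangle `u v w`. If
`S` holds the last edges of some squares of paths, this holds those of the squares of paths with one
vertex more. -/
def nextRel (G : SimpleGraph W) (A : Finset W) (S : W → W → Prop) (v w : W) : Prop :=
  G.Adj v w ∧ ∃ u ∈ A, S u v ∧ G.Adj u w

lemma nextRel_le_adj (G : SimpleGraph W) (A : Finset W) (S : W → W → Prop) :
    nextRel G A S ≤ G.Adj := fun _ _ h => h.1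

lemma nextRel_mono (hA : A ⊆ A') : nextRel G A S ≤ nextRel G A' S :=
  fun _ _ ⟨hvw, u, hu, h⟩ => ⟨hvw, u, hA hu, h⟩

/-- Every edge between `A` and `B` closes at least `d` triangles with vertices of `C`. -/
def ClosesTriangles (G : SimpleGraph W) (A B C : Finset W) (d : ℝ) : Prop :=
  ∀ u ∈ A, ∀ v ∈ B, G.Adj u v → d ≤ #{w ∈ C | G.Adj u w ∧ G.Adj v w}

lemma ClosesTriangles.anti_left (h : ClosesTriangles G A' B C d) (hA : A ⊆ A') :
    ClosesTriangles G A B C d := fun u hu => h u (hA hu)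

/-- At least `c` vertices of `A` are related by `S` to at least `b` vertices of `B`. -/
def ManyOut (S : W → W → Prop) (A B : Finset W) (c b : ℝ) : Prop :=
  ∃ X ⊆ A, c ≤ #X ∧ ∀ x ∈ X, b ≤ #(B.bipartiteAbove S x)

lemma ManyOut.mono {S' : W → W → Prop} {c : ℝ} (h : ManyOut S A B c b) (hS : S ≤ S') :
    ManyOut S' A B c b := by
  obtain ⟨X, hXA, hcard, hX⟩ := h
  exact ⟨X, hXA, hcard, fun x hx => (hX x hx).trans <| Nat.cast_le.2 <| Finset.card_le_card <|
    Finset.monotone_filter_right _ fun y _ => hS x y⟩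

section Growth

variable [Fintype W]

lemma EdgeBounded.card_interedges_le (hG : EdgeBounded G p D) (hS : S ≤ G.Adj)
    (hAB : Disjoint A B) :
    (#(Rel.interedges S A B) : ℝ) ≤ 2 * p * (#A * #B) + D * (#A + #B) :=
  (card_interedges_mono subset_rfl subset_rfl hS).trans (hG.card_edges_le A B hAB)

lemma EdgeBounded.card_bipartiteBelow_le (hG : EdgeBounded G p D) (hS : S ≤ G.Adj)
    (A : Finset W) (v : W) : (#(A.bipartiteBelow S v) : ℝ) ≤ 2 * p * Fintype.card W + D := by
  refine (Nat.cast_le.2 ?_).trans (hG.degree_le v)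
  rw [← SimpleGraph.card_neighborFinset_eq_degree]
  refine Finset.card_le_card fun u hu => ?_
  rw [Finset.mem_bipartiteBelow] at hu
  simpa using (hS u v hu.2).symm

/-- The pairs of an in-neighbour and an out-neighbour of `v` are the ends of a graph that is dense
because of the triangles, and sparse because `G` is `EdgeBounded`. -/
lemma mul_card_bipartiteBelow_le (hG : EdgeBounded G p D) (hAC : Disjoint A C) (hS : S ≤ G.Adj)
    (ht : ClosesTriangles G A B C d) {v : W} (hv : v ∈ B) :
    d * #(A.bipartiteBelow S v) ≤
      2 * p * (#(A.bipartiteBelow S v) * #(C.bipartiteAbove (nextRel G A S) v)) +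
        D * (#(A.bipartiteBelow S v) + #(C.bipartiteAbove (nextRel G A S) v)) := by
  refine le_trans ?_ <| hG.card_interedges_le le_rfl <|
    hAC.mono (Finset.filter_subset _ _) (Finset.filter_subset _ _)
  rw [card_interedges_eq_sum_bipartiteAbove, mul_comm, ← nsmul_eq_mul]
  refine Finset.card_nsmul_le_sum _ _ _ fun u hu => ?_
  rw [Finset.mem_bipartiteBelow] at hu
  refine (ht u hu.1 v hv (hS u v hu.2)).trans <|
    Nat.cast_le.2 <| Finset.card_le_card fun w hw => ?_
  obtain ⟨hwC, huw, hvw⟩ := Finset.mem_filter.1 hw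
  simp only [Finset.mem_bipartiteAbove]
  exact ⟨⟨hwC, hvw, u, hu.1, hu.2, huw⟩, huw⟩

lemma mul_card_le_card_of_unsaturated (hG : EdgeBounded G p D) (hAC : Disjoint A C)
    (hS : S ≤ G.Adj) (ht : ClosesTriangles G A B C d) (hDL : D ≤ L) (hL : 0 < L) (hDd : 2 * D ≤ d)
    {v : W} (hv : v ∈ B) (hvL : p * #(A.bipartiteBelow S v) ≤ L) :
    d / (6 * L) * #(A.bipartiteBelow S v) ≤ #(C.bipartiteAbove (nextRel G A S) v) := by
  have h := mul_card_bipartiteBelow_le hG hAC hS ht hv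
  set x : ℝ := (#(A.bipartiteBelow S v) : ℝ)
  set y : ℝ := (#(C.bipartiteAbove (nextRel G A S) v) : ℝ)
  have hx0 : 0 ≤ x := Nat.cast_nonneg _
  have hy0 : 0 ≤ y := Nat.cast_nonneg _
  rw [div_mul_eq_mul_div, div_le_iff₀ (by positivity)]
  nlinarith [mul_le_mul_of_nonneg_right hvL hy0, mul_le_mul_of_nonneg_right hDL hy0,
    mul_le_mul_of_nonneg_right hDd hx0]

lemma le_card_of_saturated (hG : EdgeBounded G p D) (hAC : Disjoint A C) (hS : S ≤ G.Adj)
    (ht : ClosesTriangles G A B C d) (hp : 0 < p) (hD : 0 < D) (hDd : 2 * D ≤ d)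
    {v : W} (hv : v ∈ B) (hvD : D ≤ p * #(A.bipartiteBelow S v)) :
    d / (6 * p) ≤ #(C.bipartiteAbove (nextRel G A S) v) := by
  have h := mul_card_bipartiteBelow_le hG hAC hS ht hv
  set x : ℝ := (#(A.bipartiteBelow S v) : ℝ)
  set y : ℝ := (#(C.bipartiteAbove (nextRel G A S) v) : ℝ)
  have hx0 : 0 < x := pos_of_mul_pos_right (hD.trans_le hvD) hp.le
  have hy0 : 0 ≤ y := Nat.cast_nonneg _
  rw [div_le_iff₀ (by positivity)]
  refine le_of_mul_le_mul_left ?_ hx0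
  nlinarith [mul_le_mul_of_nonneg_right hvD hy0, mul_le_mul_of_nonneg_right hDd hx0.le]

lemma mul_sum_le_card_interedges_of_unsaturated (hG : EdgeBounded G p D) (hAC : Disjoint A C)
    (hS : S ≤ G.Adj) (ht : ClosesTriangles G A B C d) (hDL : D ≤ L) (hL : 0 < L) (hDd : 2 * D ≤ d)
    {R : Finset W} (hRB : R ⊆ B) (hR : ∀ v ∈ R, p * #(A.bipartiteBelow S v) ≤ L) :
    d / (6 * L) * ∑ v ∈ R, (#(A.bipartiteBelow S v) : ℝ) ≤
      #(Rel.interedges (nextRel G A S) B C) := by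
  rw [card_interedges_eq_sum_bipartiteAbove, Finset.mul_sum]
  exact (Finset.sum_le_sum fun v hv =>
    mul_card_le_card_of_unsaturated hG hAC hS ht hDL hL hDd (hRB hv) (hR v hv)).trans
      (Finset.sum_le_sum_of_subset_of_nonneg hRB fun _ _ _ => Nat.cast_nonneg _)

lemma sum_heavy_le (hG : EdgeBounded G p D) (hTC : Disjoint T C) (hS : S ≤ G.Adj) :
    ∑ w ∈ C with ¬ (#(T.bipartiteBelow S w) : ℝ) ≤ 4 * p * #T + 2 * D,
      (#(T.bipartiteBelow S w) : ℝ) ≤ 2 * D * #T := by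
  set Z := {w ∈ C | ¬ (#(T.bipartiteBelow S w) : ℝ) ≤ 4 * p * #T + 2 * D}
  have hupper : ∑ w ∈ Z, (#(T.bipartiteBelow S w) : ℝ) ≤ 2 * p * (#T * #Z) + D * (#T + #Z) := by
    rw [← card_interedges_eq_sum_bipartiteBelow]
    exact hG.card_interedges_le hS (hTC.mono_right (Finset.filter_subset _ _))
  have hlower : #Z * (4 * p * #T + 2 * D) ≤ ∑ w ∈ Z, (#(T.bipartiteBelow S w) : ℝ) := by
    rw [← nsmul_eq_mul]
    exact Finset.card_nsmul_le_sum _ _ _ fun w hw => (not_le.1 (Finset.mem_filter.1 hw).2).le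
  linarith

lemma half_mul_le_sum_light (hG : EdgeBounded G p D) (hTC : Disjoint T C) (hS : S ≤ G.Adj)
    (hDb : 4 * D ≤ b) (hT : ∀ v ∈ T, b ≤ #(C.bipartiteAbove S v)) :
    #T * b / 2 ≤ ∑ w ∈ C with (#(T.bipartiteBelow S w) : ℝ) ≤ 4 * p * #T + 2 * D,
      (#(T.bipartiteBelow S w) : ℝ) := by
  have htotal : #T * b ≤ ∑ w ∈ C, (#(T.bipartiteBelow S w) : ℝ) := by
    rw [← card_interedges_eq_sum_bipartiteBelow, card_interedges_eq_sum_bipartiteAbove,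
      ← nsmul_eq_mul]
    exact Finset.card_nsmul_le_sum _ _ _ hT
  have hheavy := sum_heavy_le hG hTC hS
  rw [← Finset.sum_filter_add_sum_filter_not C
    fun w => (#(T.bipartiteBelow S w) : ℝ) ≤ 4 * p * #T + 2 * D] at htotal
  nlinarith [mul_le_mul_of_nonneg_left hDb (Nat.cast_nonneg (α := ℝ) #T)]

/-- Only the vertices with at most `4 * p * #T + 2 * D` in-neighbours are counted: they receive half
of the pairs, and each of them only a few, so there must be many of them. -/
lemma manyOut_nextRel_of_le_card (hG : EdgeBounded G p D) {E : Finset W} (hTC : Disjoint T C)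
    (hTE : Disjoint T E) (hS : S ≤ G.Adj) (ht : ClosesTriangles G T C E d) (hp : 0 < p)
    (hD : 0 < D) (hDd : 2 * D ≤ d) (hDb : 4 * D ≤ b)
    (hT : ∀ v ∈ T, b ≤ #(C.bipartiteAbove S v)) (hDT : 2 * D ≤ p * #T)
    (hDC : 4 * D * #C ≤ p * (#T * b)) :
    ManyOut (nextRel G T S) C E (b / (20 * p)) (d / (6 * p)) := by
  have hT0 : (0 : ℝ) < #T := pos_of_mul_pos_right (by linarith) hp.le
  set Y := {w ∈ C | (#(T.bipartiteBelow S w) : ℝ) ≤ 4 * p * #T + 2 * D}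
  set X := {w ∈ Y | D / p < (#(T.bipartiteBelow S w) : ℝ)}
  have hYC : Y ⊆ C := Finset.filter_subset _ _
  have hXY : X ⊆ Y := Finset.filter_subset _ _
  refine ⟨X, hXY.trans hYC, ?_, fun w hw => ?_⟩
  · have hlower : #T * b / 4 ≤ ∑ w ∈ X, (#(T.bipartiteBelow S w) : ℝ) := by
      have hlight := half_mul_le_sum_light hG hTC hS hDb hT
      have hsplit := sum_le_sum_filter_lt_add Y (fun w => (#(T.bipartiteBelow S w) : ℝ))
        (θ := D / p) (by positivity)
      have hsmall : #Y * (D / p) ≤ #T * b / 4 := by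
        have : (#Y : ℝ) ≤ #C := Nat.cast_le.2 (Finset.card_le_card hYC)
        rw [mul_div_assoc', div_le_iff₀ hp]
        nlinarith
      linarith
    have hupper : ∑ w ∈ X, (#(T.bipartiteBelow S w) : ℝ) ≤ #X * (5 * (p * #T)) := by
      rw [← nsmul_eq_mul]
      refine Finset.sum_le_card_nsmul _ _ _ fun w hw => ?_
      linarith [(Finset.mem_filter.1 (hXY hw)).2]
    rw [div_le_iff₀ (by positivity)]
    refine le_of_mul_le_mul_left ?_ hT0
    linarith
  · refine le_card_of_saturated hG hTE hS ht hp hD hDd (hYC (hXY hw)) ?_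
    have := (Finset.mem_filter.1 hw).2
    rw [div_lt_iff₀ hp] at this
    linarith

/-! ### Two steps along the square of a path -/

variable {V₀ V₁ V₂ V₃ : Finset W}

lemma card_interedges_le_mul_card_saturated (hG : EdgeBounded G p D) (hS : S ≤ G.Adj)
    (hDN : D ≤ p * Fintype.card W)
    (hT : #(Rel.interedges S V₀ V₁) / 2 ≤ ∑ v ∈ T, (#(V₀.bipartiteBelow S v) : ℝ)) :
    (#(Rel.interedges S V₀ V₁) : ℝ) ≤ 6 * p * Fintype.card W * #T := by
  have : ∑ v ∈ T, (#(V₀.bipartiteBelow S v) : ℝ) ≤ #T * (3 * p * Fintype.card W) := by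
    rw [← nsmul_eq_mul]
    refine Finset.sum_le_card_nsmul _ _ _ fun v _ => ?_
    linarith [hG.card_bipartiteBelow_le hS V₀ v]
  linarith

lemma growth_of_unsaturated (hG : EdgeBounded G p D) (h02 : Disjoint V₀ V₂) (hS : S ≤ G.Adj)
    (ht : ClosesTriangles G V₀ V₁ V₂ d) (hp : 0 < p) (hDL : D ≤ L) (hL : 0 < L) (hDd : 2 * D ≤ d)
    (hd : 0 ≤ d)
    (hunsat : #(Rel.interedges S V₀ V₁) / 2 ≤
      ∑ v ∈ V₁ with p * #(V₀.bipartiteBelow S v) ≤ L, (#(V₀.bipartiteBelow S v) : ℝ)) :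
    (#(Rel.interedges S V₀ V₁) : ℝ) ≤ 2 * Fintype.card W * L / p ∧
      d / (12 * L) * #(Rel.interedges S V₀ V₁) ≤ #(Rel.interedges (nextRel G V₀ S) V₁ V₂) := by
  set R := {v ∈ V₁ | p * #(V₀.bipartiteBelow S v) ≤ L}
  constructor
  · have hsum : ∑ v ∈ R, (#(V₀.bipartiteBelow S v) : ℝ) ≤ #R * (L / p) := by
      rw [← nsmul_eq_mul]
      refine Finset.sum_le_card_nsmul _ _ _ fun v hv => ?_
      rw [le_div_iff₀' hp]
      exact (Finset.mem_filter.1 hv).2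
    have hRW : #R * (L / p) ≤ Fintype.card W * (L / p) := by
      gcongr
      exact_mod_cast Finset.card_le_univ R
    rw [mul_assoc, mul_div_assoc, mul_div_assoc]
    linarith
  · calc d / (12 * L) * #(Rel.interedges S V₀ V₁)
        = d / (6 * L) * (#(Rel.interedges S V₀ V₁) / 2) := by ring
      _ ≤ d / (6 * L) * ∑ v ∈ R, (#(V₀.bipartiteBelow S v) : ℝ) := by gcongr
      _ ≤ _ := mul_sum_le_card_interedges_of_unsaturated hG h02 hS ht hDL hL hDd
          (Finset.filter_subset _ _) fun v hv => (Finset.mem_filter.1 hv).2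

/-- If the set `T` of starting points is small, then its out-neighbourhoods hardly overlap. -/
lemma growth_of_card_le (hG : EdgeBounded G p D) (hTC : Disjoint T C) {E : Finset W}
    (hTE : Disjoint T E) (hS : S ≤ G.Adj) (ht : ClosesTriangles G T C E d) (hp : 0 < p)
    (hN : 0 < (Fintype.card W : ℝ)) (hDL : D ≤ L) (hL : 0 < L) (hDd : 2 * D ≤ d) (hd : 0 ≤ d)
    (hDb : 4 * D ≤ d / (6 * p)) (hT : ∀ v ∈ T, d / (6 * p) ≤ #(C.bipartiteAbove S v))
    (hTL : p * (4 * p * #T + 2 * D) ≤ L) {s : ℝ} (hs : s ≤ 6 * p * Fintype.card W * #T) :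
    d ^ 2 / (432 * L * (p ^ 2 * Fintype.card W)) * s ≤
      #(Rel.interedges (nextRel G T S) C E) := by
  calc d ^ 2 / (432 * L * (p ^ 2 * Fintype.card W)) * s
      ≤ d ^ 2 / (432 * L * (p ^ 2 * Fintype.card W)) * (6 * p * Fintype.card W * #T) := by gcongr
    _ = d / (6 * L) * (#T * (d / (6 * p)) / 2) := by field_simp; ring
    _ ≤ d / (6 * L) * ∑ w ∈ C with (#(T.bipartiteBelow S w) : ℝ) ≤ 4 * p * #T + 2 * D,
          (#(T.bipartiteBelow S w) : ℝ) := by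
        gcongr
        exact half_mul_le_sum_light hG hTC hS hDb hT
    _ ≤ _ := mul_sum_le_card_interedges_of_unsaturated hG hTE hS ht hDL hL hDd
        (Finset.filter_subset _ _) fun w hw => by
          refine le_trans ?_ hTL
          gcongr
          exact (Finset.mem_filter.1 hw).2

/-- `T` is a set of saturated vertices of `V₁`. If `T` is small, then its out-neighbourhoods hardly
overlap and the pairs multiply in the next step; if `T` is large, they cover `V₂` well. -/
lemma manyOut_or_growth_of_saturated (hG : EdgeBounded G p D) (hTC : Disjoint T C) {E : Finset W}
    (hTE : Disjoint T E) (hS : S ≤ G.Adj) (ht : ClosesTriangles G T C E d) (hp : 0 < p)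
    (hp1 : p ≤ 1) (hD : 0 < D) (hDL : 10 * D ≤ L) (hDd : 24 * D ≤ d)
    (hN : 0 < (Fintype.card W : ℝ)) (hLd : 120 * D * (p ^ 2 * Fintype.card W) ≤ L * d)
    (hT : ∀ v ∈ T, d / (6 * p) ≤ #(C.bipartiteAbove S v)) {s : ℝ}
    (hs : s ≤ 6 * p * Fintype.card W * #T) :
    ManyOut (nextRel G T S) C E (d / (120 * p ^ 2)) (d / (6 * p)) ∨
      s ≤ 2 * Fintype.card W * L / p ∧
        d ^ 2 / (432 * L * (p ^ 2 * Fintype.card W)) * s ≤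
          #(Rel.interedges (nextRel G T S) C E) := by
  have hL : 0 < L := by linarith
  have hDb : 4 * D ≤ d / (6 * p) := by
    rw [le_div_iff₀ (by positivity)]
    nlinarith
  rcases le_or_gt (p * (4 * p * #T + 2 * D)) L with hsmall | hlarge
  · refine Or.inr ⟨?_, growth_of_card_le hG hTC hTE hS ht hp hN (by linarith) hL (by linarith)
      (by linarith) hDb hT hsmall hs⟩
    rw [le_div_iff₀ hp]
    have hTL : 4 * p * (p * #T) ≤ L := by nlinarith
    nlinarith
  · left
    have hTL : L ≤ 5 * (p ^ 2 * #T) := by nlinarith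
    have hpT : p ^ 2 * #T ≤ p * #T := by nlinarith
    have hCN : (#C : ℝ) ≤ Fintype.card W := Nat.cast_le.2 C.card_le_univ
    have hDC : 24 * D * #C ≤ #T * d := by
      have : p ^ 2 * (24 * D * Fintype.card W) ≤ p ^ 2 * (#T * d) := by nlinarith
      have := le_of_mul_le_mul_left this (by positivity)
      nlinarith
    have h := manyOut_nextRel_of_le_card hG hTC hTE hS ht hp hD (by linarith) hDb hT (by linarith)
      (by field_simp; linarith)
    convert h using 1
    field_simp
    ring

/-- Unsaturated vertices of `V₁` multiply the pairs in one step. If they see too few of the pairs,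
then there are many saturated vertices. -/
theorem manyOut_or_growth (hG : EdgeBounded G p D)
    (h02 : Disjoint V₀ V₂) (h12 : Disjoint V₁ V₂) (h13 : Disjoint V₁ V₃) (hS : S ≤ G.Adj)
    (ht : ClosesTriangles G V₀ V₁ V₂ d) (ht' : ClosesTriangles G V₁ V₂ V₃ d)
    (hp : 0 < p) (hp1 : p ≤ 1) (hD : 0 < D) (hDL : 10 * D ≤ L) (hDd : 24 * D ≤ d)
    (hDN : D ≤ p * Fintype.card W) (hLd : 120 * D * (p ^ 2 * Fintype.card W) ≤ L * d) :
    ManyOut (nextRel G V₁ (nextRel G V₀ S)) V₂ V₃ (d / (120 * p ^ 2)) (d / (6 * p)) ∨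
    (#(Rel.interedges S V₀ V₁) : ℝ) ≤ 2 * Fintype.card W * L / p ∧
      (d / (12 * L) * #(Rel.interedges S V₀ V₁) ≤ #(Rel.interedges (nextRel G V₀ S) V₁ V₂) ∨
        d ^ 2 / (432 * L * (p ^ 2 * Fintype.card W)) * #(Rel.interedges S V₀ V₁) ≤
          #(Rel.interedges (nextRel G V₁ (nextRel G V₀ S)) V₂ V₃)) := by
  have hsplit := Finset.sum_filter_add_sum_filter_not V₁
    (fun v => p * #(V₀.bipartiteBelow S v) ≤ L) fun v => (#(V₀.bipartiteBelow S v) : ℝ)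
  rw [← card_interedges_eq_sum_bipartiteBelow S V₀ V₁] at hsplit
  rcases le_total ((#(Rel.interedges S V₀ V₁) : ℝ) / 2)
      (∑ v ∈ V₁ with p * #(V₀.bipartiteBelow S v) ≤ L, (#(V₀.bipartiteBelow S v) : ℝ))
    with hunsat | hunsat
  · obtain ⟨hsL, hgrow⟩ := growth_of_unsaturated hG h02 hS ht hp (by linarith) (by linarith)
      (by linarith) (by linarith) hunsat
    exact Or.inr ⟨hsL, Or.inl hgrow⟩
  set T := {v ∈ V₁ | ¬ p * #(V₀.bipartiteBelow S v) ≤ L}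
  have hTV : T ⊆ V₁ := Finset.filter_subset _ _
  have hsat : ∀ v ∈ T, d / (6 * p) ≤ #(V₂.bipartiteAbove (nextRel G V₀ S) v) := fun v hv =>
    le_card_of_saturated hG h02 hS ht hp hD (by linarith) (hTV hv)
      (by linarith [(Finset.mem_filter.1 hv).2])
  have hmono : nextRel G T (nextRel G V₀ S) ≤ nextRel G V₁ (nextRel G V₀ S) := nextRel_mono hTV
  refine (manyOut_or_growth_of_saturated hG (h12.mono_left hTV) (h13.mono_left hTV)
    (nextRel_le_adj G V₀ S) (ht'.anti_left hTV) hp hp1 hD hDL hDd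
    (pos_of_mul_pos_right (hD.trans_le hDN) hp.le) hLd hsat
    (card_interedges_le_mul_card_saturated hG hS hDN (by linarith))).imp
    (fun h => h.mono hmono) fun h => ⟨h.1, Or.inr <| h.2.trans ?_⟩
  exact card_interedges_mono subset_rfl subset_rfl hmono

end Growth

/-! ### Growth of the set of reached edges -/

section Reach

variable {V : ℕ → Finset W} {e : W × W} {k l : ℕ} {f : ℕ → W} {u v w : W}

/-- The relation between the last two vertices of the squares of paths that start with the edge `e`
and have their `i`-th vertex in `V i`. Only the vertices before the last two are required to lie in
these sets, so this has to be read as a relation between `V j` and `V (j + 1)`. -/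
def reach (G : SimpleGraph W) (V : ℕ → Finset W) (e : W × W) : ℕ → W → W → Prop
  | 0 => fun u v => (u, v) = e
  | j + 1 => nextRel G (V j) (reach G V e j)

lemma reach_le_adj (he : G.Adj e.1 e.2) : ∀ j, reach G V e j ≤ G.Adj
  | 0 => by rintro u v rfl; exact he
  | _ + 1 => nextRel_le_adj _ _ _

/-- The vertices `f 0, …, f l` form the square of a path in `G`, with `f i ∈ V i`. -/
structure IsSquarePath (G : SimpleGraph W) (V : ℕ → Finset W) (f : ℕ → W) (l : ℕ) : Prop where
  mem : ∀ i ≤ l, f i ∈ V i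
  adj : ∀ i j, i < j → j ≤ i + 2 → j ≤ l → G.Adj (f i) (f j)

lemma IsSquarePath.update (hf : IsSquarePath G V f (l + 1)) (hw : w ∈ V (l + 2))
    (h : G.Adj (f l) w) (h' : G.Adj (f (l + 1)) w) :
    IsSquarePath G V (Function.update f (l + 2) w) (l + 2) where
  mem i hi := by
    rcases hi.lt_or_eq with hi | rfl
    · rw [Function.update_of_ne hi.ne]
      exact hf.mem i (by omega)
    · rwa [Function.update_self]
  adj i j hij hj hjl := by
    rw [Function.update_of_ne (by omega : i ≠ l + 2)]
    rcases hjl.lt_or_eq with hjl | rfl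
    · rw [Function.update_of_ne hjl.ne]
      exact hf.adj i j hij hj (by omega)
    · rw [Function.update_self]
      obtain rfl | rfl : i = l ∨ i = l + 1 := by omega
      exacts [h, h']

lemma exists_isSquarePath_of_reach (he : e ∈ edgesBetween G (V 0) (V 1)) (j : ℕ)
    (h : reach G V e j u v) (hu : u ∈ V j) (hv : v ∈ V (j + 1)) :
    ∃ f, IsSquarePath G V f (j + 1) ∧ (f 0, f 1) = e ∧ (f j, f (j + 1)) = (u, v) := by
  induction j generalizing u v with
  | zero =>
    obtain rfl : (u, v) = e := h
    refine ⟨fun i => if i = 0 then u else v, ⟨fun i hi => ?_, fun i j hij _ hj => ?_⟩, rfl, rfl⟩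
    · interval_cases i
      exacts [hu, hv]
    · obtain ⟨rfl, rfl⟩ : i = 0 ∧ j = 1 := by omega
      exact (mem_edgesBetween.1 he).2.2
  | succ j ih =>
    obtain ⟨huv, x, hx, hxu, hxv⟩ := h
    obtain ⟨f, hf, hfe, hfj⟩ := ih hxu hx hu
    obtain ⟨rfl, rfl⟩ := Prod.ext_iff.1 hfj
    refine ⟨_, hf.update hv hxv huv, ?_, ?_⟩
    · rwa [Function.update_of_ne (by omega), Function.update_of_ne (by omega)]
    · rw [Function.update_of_ne (by omega), Function.update_self]

lemma expands_of_reach {V : Fin (k + 2) → Finset W} {V' : ℕ → Finset W}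
    (hV : ∀ i : Fin (k + 2), V' i = V i) (hdisj : ∀ i j, i ≠ j → Disjoint (V i) (V j))
    (he : e ∈ edgesBetween G (V' 0) (V' 1)) {E' : Finset (W × W)}
    (hE' : E' ⊆ Rel.interedges (reach G V' e k) (V' k) (V' (k + 1))) : Expands G V e E' := by
  intro e' he'
  obtain ⟨hu, hv, h⟩ := Rel.mem_interedges_iff.1 (hE' he')
  obtain ⟨f, hf, hfe, hfe'⟩ := exists_isSquarePath_of_reach he k h hu hv
  have hmem : ∀ i : Fin (k + 2), f i ∈ V i := fun i => hV i ▸ hf.mem i (by omega)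
  refine ⟨⟨⟨fun i => f i, ?_⟩, fun i j hij => ?_⟩, hmem, hfe.symm, hfe'.symm⟩
  · rintro i j ⟨hne, hij, hji⟩
    rcases lt_or_gt_of_ne hne with h | h
    · exact hf.adj i j h hji (by omega)
    · exact (hf.adj j i h hij (by omega)).symm
  · by_contra hne
    have hij : f i = f j := hij
    exact Finset.disjoint_left.1 (hdisj i j hne) (hmem i) (hij ▸ hmem j)

/-- Two steps may be needed for one factor `g`, whence the square. -/
lemma exists_pow_le_sq {s : ℕ → ℝ} {g : ℝ} (hs : ∀ j, 0 ≤ s j) (hg : 1 ≤ g) (hs2 : g ^ 2 ≤ s 2)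
    (hstep : ∀ j, j < k → g * s j ≤ s (j + 1) ∨ g * s j ≤ s (j + 2)) :
    ∀ l, l + 3 ≤ k → ∃ j, (j = l + 1 ∨ j = l + 2) ∧ g ^ (j + 2) ≤ s j ^ 2
  | 0, _ => ⟨2, Or.inr rfl, by rw [show 2 + 2 = 2 * 2 from rfl, pow_mul]; gcongr⟩
  | l + 1, hl => by
    obtain ⟨j, rfl | rfl, hj⟩ := exists_pow_le_sq hs hg hs2 hstep l (by omega)
    · have hgrow : ∀ x, g * s (l + 1) ≤ x → g ^ (l + 1 + 2 + 2) ≤ x ^ 2 := fun x hx => by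
        have := hs (l + 1)
        calc g ^ (l + 1 + 2 + 2) = g ^ (l + 1 + 2) * g ^ 2 := pow_add _ _ _
          _ ≤ s (l + 1) ^ 2 * g ^ 2 := by gcongr
          _ = (g * s (l + 1)) ^ 2 := by ring
          _ ≤ x ^ 2 := by gcongr
      rcases hstep (l + 1) (by omega) with h | h
      · exact ⟨l + 2, Or.inl rfl, (pow_le_pow_right₀ hg (by omega)).trans (hgrow _ h)⟩
      · exact ⟨l + 3, Or.inr rfl, hgrow _ h⟩
    · exact ⟨l + 2, Or.inl rfl, hj⟩

/-- The relations between the number `N` of vertices, the edge probability `p`, the error term `D`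
of `EdgeBounded`, and the number `d` of triangles on each edge, under which the set of reached edges
saturates within `k` steps. The growth rate is `p ^ 2 * N / D ^ 3`. -/
structure ExpansionRegime (k : ℕ) (N p D d μ : ℝ) : Prop where
  one_le_N : 1 ≤ N
  p_pos : 0 < p
  p_le_one : p ≤ 1
  μ_pos : 0 < μ
  μ_le_one : μ ≤ 1
  le_sq_mul : 432 ≤ μ ^ 2 * D
  mul_le : μ * (p ^ 2 * N) ≤ d
  pow_mul_pow_le : N ^ 3 * D ^ (3 * k + 5) ≤ (p ^ 2 * N) ^ (k + 1)

namespace ExpansionRegime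

variable {N μ : ℝ} (h : ExpansionRegime k N p D d μ)
include h

lemma le_mul : 432 ≤ μ * D := by
  nlinarith [h.le_sq_mul, h.μ_pos, h.μ_le_one]

lemma le_D : 432 ≤ D := by
  nlinarith [h.le_mul, h.μ_pos, h.μ_le_one]

lemma D_pow_three_le : D ^ 3 ≤ p ^ 2 * N := by
  have hN := h.one_le_N
  have hD := h.le_D
  have hp := h.p_pos
  refine le_of_pow_le_pow_left₀ (Nat.succ_ne_zero k) (by positivity) ?_
  calc (D ^ 3) ^ (k + 1) = 1 * D ^ (3 * k + 3) := by ring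
    _ ≤ N ^ 3 * D ^ (3 * k + 5) := by
        gcongr
        · exact one_le_pow₀ hN
        · linarith
        · omega
    _ ≤ (p ^ 2 * N) ^ (k + 1) := h.pow_mul_pow_le

lemma sq_mul_le_mul : p ^ 2 * N ≤ p * N := by
  nlinarith [mul_nonneg h.p_pos.le (zero_le_one.trans h.one_le_N), h.p_le_one]

lemma D_le : D ≤ p * N :=
  (le_self_pow₀ (by linarith [h.le_D]) three_ne_zero).trans
    (h.D_pow_three_le.trans h.sq_mul_le_mul)

lemma three_le_k : 3 ≤ k := by
  have hp := h.p_pos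
  have hN := h.one_le_N
  have hD := h.le_D
  by_contra! hk
  have : N ^ 3 * 1 < N ^ 3 * 1 := by
    calc N ^ 3 * 1 < N ^ 3 * D ^ (3 * k + 5) := by
          gcongr
          exact one_lt_pow₀ (by linarith) (by omega)
      _ ≤ (p ^ 2 * N) ^ (k + 1) := h.pow_mul_pow_le
      _ ≤ N ^ (k + 1) := by
          gcongr
          exact mul_le_of_le_one_left (by linarith) (pow_le_one₀ hp.le h.p_le_one)
      _ ≤ N ^ 3 * 1 := by
          rw [mul_one]
          exact pow_le_pow_right₀ hN (by omega)
  exact this.false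

lemma le_d : 432 * D ^ 2 ≤ d := by
  have hD := h.le_D
  calc 432 * D ^ 2 ≤ μ * D * D ^ 2 := by gcongr; exact h.le_mul
    _ = μ * D ^ 3 := by ring
    _ ≤ μ * (p ^ 2 * N) := by gcongr; exacts [h.μ_pos.le, h.D_pow_three_le]
    _ ≤ d := h.mul_le

lemma one_le_rate : 1 ≤ p ^ 2 * N / D ^ 3 := by
  have hD := h.le_D
  rw [one_le_div (by positivity)]
  exact h.D_pow_three_le

lemma mul_le_D_mul_d : 432 * (p ^ 2 * N) ≤ D * d := by
  have hp := h.p_pos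
  have hN := h.one_le_N
  have hD := h.le_D
  calc 432 * (p ^ 2 * N) ≤ μ * D * (p ^ 2 * N) := by gcongr; exact h.le_mul
    _ = D * (μ * (p ^ 2 * N)) := by ring
    _ ≤ D * d := by gcongr; exact h.mul_le

lemma rate_le_div : p ^ 2 * N / D ^ 3 ≤ d / (12 * D ^ 2) := by
  have hD := h.le_D
  have hp := h.p_pos
  have hN := h.one_le_N
  rw [div_le_div_iff₀ (by positivity) (by positivity)]
  calc p ^ 2 * N * (12 * D ^ 2) ≤ 432 * (p ^ 2 * N) * D ^ 2 := by
        have : 0 ≤ p ^ 2 * N * D ^ 2 := by positivity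
        linarith
    _ ≤ D * d * D ^ 2 := mul_le_mul_of_nonneg_right h.mul_le_D_mul_d (by positivity)
    _ = d * D ^ 3 := by ring

lemma rate_le_sq_div : p ^ 2 * N / D ^ 3 ≤ d ^ 2 / (432 * D ^ 2 * (p ^ 2 * N)) := by
  have hp := h.p_pos
  have hN := h.one_le_N
  have hD := h.le_D
  have hμ := h.μ_pos
  rw [div_le_div_iff₀ (by positivity) (by positivity)]
  calc p ^ 2 * N * (432 * D ^ 2 * (p ^ 2 * N)) = 432 * (p ^ 2 * N) ^ 2 * D ^ 2 := by ring
    _ ≤ μ ^ 2 * D * (p ^ 2 * N) ^ 2 * D ^ 2 := by gcongr; exact h.le_sq_mul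
    _ = (μ * (p ^ 2 * N)) ^ 2 * D ^ 3 := by ring
    _ ≤ d ^ 2 * D ^ 3 := by gcongr; exact h.mul_le

lemma lt_rate_pow : (2 * N * D ^ 2 / p) ^ 2 < (p ^ 2 * N / D ^ 3) ^ k := by
  have hp := h.p_pos
  have hN := h.one_le_N
  have hD := h.le_D
  rw [div_pow, div_pow, div_lt_div_iff₀ (by positivity) (by positivity)]
  refine lt_of_mul_lt_mul_right ?_ (zero_le_one.trans hN)
  calc (2 * N * D ^ 2) ^ 2 * (D ^ 3) ^ k * N = N ^ 3 * D ^ (3 * k + 4) * 4 := by ring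
    _ < N ^ 3 * D ^ (3 * k + 4) * D := by gcongr; linarith
    _ = N ^ 3 * D ^ (3 * k + 5) := by ring
    _ ≤ (p ^ 2 * N) ^ (k + 1) := h.pow_mul_pow_le
    _ = (p ^ 2 * N) ^ k * p ^ 2 * N := by ring

end ExpansionRegime

lemma card_bipartiteBelow_reach_zero_le (A : Finset W) (v : W) :
    #(A.bipartiteBelow (reach G V e 0) v) ≤ 1 :=
  Finset.card_le_one.2 fun x hx y hy => by
    have hx' : (x, v) = e := ((Finset.mem_bipartiteBelow _).1 hx).2
    have hy' : (y, v) = e := ((Finset.mem_bipartiteBelow _).1 hy).2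
    exact (Prod.ext_iff.1 (hx'.trans hy'.symm)).1

lemma card_bipartiteBelow_reach_one_le (A : Finset W) (v : W) :
    #(A.bipartiteBelow (reach G V e 1) v) ≤ 1 :=
  Finset.card_le_one.2 fun x hx y hy => by
    obtain ⟨-, u, -, hx', -⟩ := ((Finset.mem_bipartiteBelow _).1 hx).2
    obtain ⟨-, u', -, hy', -⟩ := ((Finset.mem_bipartiteBelow _).1 hy).2
    exact (Prod.ext_iff.1 (Eq.trans (b := e) hx' (Eq.symm hy'))).2

variable [Fintype W] {μ : ℝ}

/-- In the first two steps all vertices are unsaturated. -/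
lemma rate_sq_le_card_reach_two (h : ExpansionRegime k (Fintype.card W) p D d μ)
    (hG : EdgeBounded G p D) (he : e ∈ edgesBetween G (V 0) (V 1))
    (hdisj : ∀ i ≤ 1, Disjoint (V i) (V (i + 2)))
    (ht : ∀ i ≤ 1, ClosesTriangles G (V i) (V (i + 1)) (V (i + 2)) d) :
    (p ^ 2 * Fintype.card W / D ^ 3) ^ 2 ≤ #(Rel.interedges (reach G V e 2) (V 2) (V 3)) := by
  have hD := h.le_D
  have hd := h.le_d
  have hstep : ∀ j ≤ 1, (∀ v, #((V j).bipartiteBelow (reach G V e j) v) ≤ 1) →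
      p ^ 2 * Fintype.card W / D ^ 3 * #(Rel.interedges (reach G V e j) (V j) (V (j + 1))) ≤
        #(Rel.interedges (reach G V e (j + 1)) (V (j + 1)) (V (j + 2))) := fun j hj hone => by
    refine le_trans ?_ <| mul_sum_le_card_interedges_of_unsaturated (L := D ^ 2) hG (hdisj j hj)
      (reach_le_adj (mem_edgesBetween.1 he).2.2 j) (ht j hj) (by nlinarith) (by positivity)
      (by nlinarith) subset_rfl fun v _ => ?_
    · rw [← card_interedges_eq_sum_bipartiteBelow]
      refine mul_le_mul_of_nonneg_right (h.rate_le_div.trans ?_) (Nat.cast_nonneg _)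
      have hd0 : 0 ≤ d := by nlinarith
      gcongr
      norm_num
    · calc p * #((V j).bipartiteBelow (reach G V e j) v) ≤ 1 * 1 := by
            gcongr
            exacts [h.p_le_one, by exact_mod_cast hone v]
        _ ≤ D ^ 2 := by nlinarith
  have hzero : (1 : ℝ) ≤ #(Rel.interedges (reach G V e 0) (V 0) (V 1)) := by
    obtain ⟨h0, h1, -⟩ := mem_edgesBetween.1 he
    exact Nat.one_le_cast.2 <| Finset.card_pos.2 ⟨e, Rel.mem_interedges_iff.2 ⟨h0, h1, rfl⟩⟩
  have hone := hstep 0 zero_le_one (card_bipartiteBelow_reach_zero_le _)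
  have htwo := hstep 1 le_rfl (card_bipartiteBelow_reach_one_le _)
  nlinarith [h.one_le_rate]

/-- Otherwise the number of reached edges would be multiplied by the rate in every one or two steps,
and outgrow the bound that holds as long as it still grows. -/
theorem exists_manyOut_reach (h : ExpansionRegime k (Fintype.card W) p D d μ)
    (hG : EdgeBounded G p D) (he : e ∈ edgesBetween G (V 0) (V 1))
    (hdisj : ∀ i j, i < j → j ≤ k + 2 → Disjoint (V i) (V j))
    (ht : ∀ i ≤ k, ClosesTriangles G (V i) (V (i + 1)) (V (i + 2)) d) :
    ∃ j ≤ k + 1, ManyOut (reach G V e j) (V j) (V (j + 1)) (d / (120 * p ^ 2)) (d / (6 * p)) := by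
  by_contra! hno
  have hk := h.three_le_k
  have hD := h.le_D
  have hd := h.le_d
  have hstep : ∀ j < k, _ := fun j hj =>
    (manyOut_or_growth (L := D ^ 2) hG (hdisj j (j + 2) (by omega) (by omega))
      (hdisj (j + 1) (j + 2) (by omega) (by omega)) (hdisj (j + 1) (j + 3) (by omega) (by omega))
      (reach_le_adj (mem_edgesBetween.1 he).2.2 j) (ht j hj.le) (ht (j + 1) hj) h.p_pos h.p_le_one
      (by linarith) (by nlinarith) (by nlinarith) h.D_le
      (by nlinarith [h.mul_le_D_mul_d])).resolve_left (hno (j + 2) (by omega))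
  set g := p ^ 2 * Fintype.card W / D ^ 3 with hg
  set s : ℕ → ℝ := fun j => #(Rel.interedges (reach G V e j) (V j) (V (j + 1))) with hs
  have hs0 : ∀ j, 0 ≤ s j := fun j => Nat.cast_nonneg _
  obtain ⟨j, hj, hgj⟩ := exists_pow_le_sq hs0 h.one_le_rate
    (rate_sq_le_card_reach_two h hG he (fun i hi => hdisj i (i + 2) (by omega) (by omega))
      fun i hi => ht i (by omega))
    (fun j hj => (hstep j hj).2.imp
      (fun hgrow => (mul_le_mul_of_nonneg_right h.rate_le_div (hs0 j)).trans hgrow)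
      fun hgrow => (mul_le_mul_of_nonneg_right h.rate_le_sq_div (hs0 j)).trans hgrow)
    (k - 3) (by omega)
  have : g ^ k < g ^ k := by
    calc g ^ k ≤ g ^ (j + 2) := pow_le_pow_right₀ h.one_le_rate (by omega)
      _ ≤ s j ^ 2 := hgj
      _ ≤ (2 * Fintype.card W * D ^ 2 / p) ^ 2 := by
          gcongr
          exact (hstep j (by omega)).1
      _ < g ^ k := h.lt_rate_pow
  exact this.false

end Reach

/-! ### Spreading by regularity -/

section Spreading

variable {X Y Z : Finset W} {q ε r m c c₁ c₂ : ℝ}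

lemma density_nonneg (G : SimpleGraph W) (A B : Finset W) : 0 ≤ density G A B := by
  unfold density
  positivity

lemma card_edgesBetween_eq_density_mul (G : SimpleGraph W) (A B : Finset W) :
    (#(edgesBetween G A B) : ℝ) = density G A B * (#A * #B) := by
  have hle : #(edgesBetween G A B) ≤ #A * #B := Rel.card_interedges_le_mul _ _ _
  refine (div_mul_cancel_of_imp fun h => ?_).symm
  exact_mod_cast Nat.le_zero.1 (hle.trans_eq (by exact_mod_cast h))

lemma ManyOut.mul_le_card_interedges (h : ManyOut S A B c b) (hb : 0 ≤ b) :
    c * b ≤ #(Rel.interedges S A B) := by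
  obtain ⟨X, hXA, hcX, hX⟩ := h
  calc c * b ≤ #X * b := by gcongr
    _ ≤ #(Rel.interedges S X B) := by
        rw [card_interedges_eq_sum_bipartiteAbove, ← nsmul_eq_mul]
        exact Finset.card_nsmul_le_sum _ _ _ hX
    _ ≤ #(Rel.interedges S A B) := card_interedges_mono hXA subset_rfl le_rfl

/-- Edge counts between subsets of `A` and `B` of size at least `r` are within a factor two of what
the density `q` predicts. -/
def IsBalanced (G : SimpleGraph W) (A B : Finset W) (q r : ℝ) : Prop :=
  ∀ X ⊆ A, ∀ Y ⊆ B, r ≤ #X → r ≤ #Y →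
    q / 2 * (#X * #Y) ≤ #(edgesBetween G X Y) ∧ (#(edgesBetween G X Y) : ℝ) ≤ 2 * q * (#X * #Y)

lemma IsRegular.isBalanced (hreg : IsRegular G ε A B) (hq : 0 ≤ q) (hε : ε ≤ 1 / 12)
    (hA : (#A : ℝ) = m) (hB : (#B : ℝ) = m) (hl : (1 - ε) * q ≤ density G A B)
    (hu : density G A B ≤ (1 + ε) * q) : IsBalanced G A B q (ε * m) := by
  intro X hX Y hY hXm hYm
  have h := abs_le.1 (hreg X hX Y hY (by rwa [hA]) (by rwa [hB]))
  rw [card_edgesBetween_eq_density_mul]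
  have hεd : ε * density G A B ≤ 1 / 12 * density G A B :=
    mul_le_mul_of_nonneg_right hε (density_nonneg G A B)
  have hεq : ε * q ≤ 1 / 12 * q := mul_le_mul_of_nonneg_right hε hq
  constructor <;> gcongr <;> linarith [h.1, h.2]

/-- A set that is too small for regularity is enlarged until it is not. -/
lemma IsBalanced.card_edgesBetween_le (h : IsBalanced G A B q r) (hq : 0 ≤ q) (hr : 0 ≤ r)
    (hA : r ≤ #A) (hB : r ≤ #B) (hY : Y ⊆ B) :
    (#(edgesBetween G A Y) : ℝ) ≤ 2 * q * (#A * (#Y + r + 1)) := by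
  rcases le_total r #Y with hrY | hYr
  · refine (h A subset_rfl Y hY hA hrY).2.trans ?_
    gcongr
    linarith
  · obtain ⟨Y', hYY', hY'B, hY'⟩ := Finset.exists_subsuperset_card_eq (n := ⌈r⌉₊) hY
      (by exact_mod_cast hYr.trans (Nat.le_ceil r)) (Nat.ceil_le.2 hB)
    have hY'r : (#Y' : ℝ) ≤ r + 1 := hY' ▸ (Nat.ceil_lt_add_one hr).le
    calc (#(edgesBetween G A Y) : ℝ) ≤ #(edgesBetween G A Y') :=
          Nat.cast_le.2 <| Finset.card_le_card <| edgesBetween_mono le_rfl subset_rfl hYY'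
      _ ≤ 2 * q * (#A * #Y') := (h A subset_rfl Y' hY'B hA (hY' ▸ Nat.le_ceil r)).2
      _ ≤ 2 * q * (#A * (#Y + r + 1)) := by
          gcongr
          linarith [Nat.cast_nonneg (α := ℝ) #Y]

lemma IsBalanced.card_filter_lt_card_nbhdIn_le (h : IsBalanced G A B q r) (hr : 0 ≤ r)
    (hA : r ≤ #A) : (#{v ∈ B | 2 * q * #A < #(nbhdIn G v A)} : ℝ) ≤ r := by
  by_contra! hcon
  set Y := {v ∈ B | 2 * q * #A < (#(nbhdIn G v A) : ℝ)}
  have hupper := (h A subset_rfl Y (Finset.filter_subset _ _) hA hcon.le).2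
  have hYne : Y.Nonempty := Finset.card_pos.1 (by exact_mod_cast hr.trans_lt hcon)
  have hlower : #Y * (2 * q * #A) < ∑ v ∈ Y, (#(A.bipartiteBelow G.Adj v) : ℝ) := by
    rw [← nsmul_eq_mul, ← Finset.sum_const]
    refine Finset.sum_lt_sum_of_nonempty hYne fun v hv => ?_
    simpa only [nbhdIn, Finset.bipartiteBelow, G.adj_comm] using (Finset.mem_filter.1 hv).2
  rw [← card_interedges_eq_sum_bipartiteBelow] at hlower
  exact (hlower.trans_le hupper).not_ge (by linarith)

/-- No edge joins the in-neighbours of `v` to the neighbours that are not reached, so by lower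
regularity the latter are few. -/
lemma mul_card_nbhdIn_le_card_bipartiteAbove_nextRel (hS : S ≤ G.Adj) (hq : 0 < q) (hε₀ : 0 ≤ ε)
    (hε : ε < 1) {v : W} (hv : IsLowerRegular G ε q (nbhdIn G v A) (nbhdIn G v C))
    (hne : (A.bipartiteBelow S v).Nonempty)
    (hin : ε * #(nbhdIn G v A) ≤ #(A.bipartiteBelow S v)) :
    (1 - ε) * #(nbhdIn G v C) ≤ #(C.bipartiteAbove (nextRel G A S) v) := by
  have hsub : C.bipartiteAbove (nextRel G A S) v ⊆ nbhdIn G v C :=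
    Finset.monotone_filter_right _ fun w _ hw => hw.1
  set Z := nbhdIn G v C \ C.bipartiteAbove (nextRel G A S) v with hZdef
  have hcard : (#Z : ℝ) + #(C.bipartiteAbove (nextRel G A S) v) = #(nbhdIn G v C) := by
    exact_mod_cast Finset.card_sdiff_add_card_eq_card hsub
  suffices hZ : (#Z : ℝ) ≤ ε * #(nbhdIn G v C) by linarith
  by_contra! hcon
  have hZne : Z.Nonempty := Finset.card_pos.1 <| by
    exact_mod_cast (show (0 : ℝ) ≤ _ by positivity).trans_lt hcon
  have hinA : A.bipartiteBelow S v ⊆ nbhdIn G v A :=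
    Finset.monotone_filter_right _ fun u _ hu => (hS u v hu).symm
  have hdens := hv _ hinA Z Finset.sdiff_subset hne hZne hin hcon.le
  have hempty : edgesBetween G (A.bipartiteBelow S v) Z = ∅ := by
    refine Finset.eq_empty_of_forall_notMem fun ⟨u, w⟩ he => ?_
    obtain ⟨hu, hw, huw⟩ := mem_edgesBetween.1 he
    simp only [Finset.mem_bipartiteBelow] at hu
    simp only [hZdef, Finset.mem_sdiff, nbhdIn, Finset.mem_filter, Finset.mem_bipartiteAbove] at hw
    exact hw.2 ⟨hw.1.1, hw.1.2, u, hu.1, hu.2, huw⟩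
  rw [density, hempty, Finset.card_empty, Nat.cast_zero, zero_div] at hdens
  nlinarith

/-- At least `c` vertices of `A` are related by `S` to all but a proportion `ε` of their neighbours
in `B`. -/
def NearlyFull (G : SimpleGraph W) (S : W → W → Prop) (A B : Finset W) (c ε : ℝ) : Prop :=
  ∃ X ⊆ A, c ≤ #X ∧ ∀ x ∈ X, (1 - ε) * #(nbhdIn G x B) ≤ #(B.bipartiteAbove S x)

/-- Three consecutive vertex sets of a regular blow-up of the square of a path, with what is needed
for spreading from the edges between `A` and `B` to those between `B` and `C`. -/
structure SpreadTriple (G : SimpleGraph W) (A B C : Finset W) (q ε m : ℝ) : Prop where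
  balanced : IsBalanced G A B q (ε * m)
  card_left : (#A : ℝ) = m
  card_mid : (#B : ℝ) = m
  lowerRegular :
    (#{v ∈ B | ¬ IsLowerRegular G ε q (nbhdIn G v A) (nbhdIn G v C)} : ℝ) ≤ ε * m
  m_pos : 0 < m
  q_pos : 0 < q
  ε_pos : 0 < ε
  ε_lt_one : ε < 1

namespace SpreadTriple

variable (h : SpreadTriple G A B C q ε m)
include h

lemma mul_le_card_left : ε * m ≤ #A := by
  rw [h.card_left]
  exact mul_le_of_le_one_left h.m_pos.le h.ε_lt_one.le

lemma mul_le_card_mid : ε * m ≤ #B := by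
  rw [h.card_mid]
  exact mul_le_of_le_one_left h.m_pos.le h.ε_lt_one.le

lemma nearlyFull_nextRel (hS : S ≤ G.Adj) (hY : Y ⊆ B)
    (hin : ∀ y ∈ Y, 2 * ε * q * m ≤ #(A.bipartiteBelow S y)) :
    NearlyFull G (nextRel G A S) B C (#Y - 2 * ε * m) ε := by
  have hε := h.ε_pos
  have hq := h.q_pos
  have hm := h.m_pos
  set Z₁ := {v ∈ B | ¬ IsLowerRegular G ε q (nbhdIn G v A) (nbhdIn G v C)} with hZ₁
  set Z₂ := {v ∈ B | 2 * q * #A < (#(nbhdIn G v A) : ℝ)} with hZ₂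
  refine ⟨Y \ (Z₁ ∪ Z₂), Finset.sdiff_subset.trans hY, ?_, fun y hy => ?_⟩
  · have hcard : (#Y : ℝ) ≤ #(Y \ (Z₁ ∪ Z₂)) + (#Z₁ + #Z₂) := by
      exact_mod_cast (Finset.card_le_card_sdiff_add_card).trans
        (Nat.add_le_add_left (Finset.card_union_le Z₁ Z₂) _)
    have hZ₂card : (#Z₂ : ℝ) ≤ ε * m :=
      h.balanced.card_filter_lt_card_nbhdIn_le (by positivity) h.mul_le_card_left
    linarith [h.lowerRegular]
  · simp only [hZ₁, hZ₂, Finset.mem_sdiff, Finset.mem_union, Finset.mem_filter, not_or, not_and,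
      not_not, not_lt] at hy
    obtain ⟨hyY, hlower, hdeg⟩ := hy
    have hyin := hin y hyY
    refine mul_card_nbhdIn_le_card_bipartiteAbove_nextRel hS hq hε.le h.ε_lt_one (hlower (hY hyY))
      (Finset.card_pos.1 ?_) ?_
    · exact_mod_cast (show 0 < 2 * ε * q * m by positivity).trans_le hyin
    · have := hdeg (hY hyY)
      rw [h.card_left] at this
      nlinarith

lemma nearlyFull_of_manyOut (hS : S ≤ G.Adj) (hc₁ : 0 ≤ c₁)
    (hmany : ManyOut S A B (c₂ * m) (c₁ * q * m)) (hε : 32 * ε ≤ c₁ * c₂) (hm : 1 ≤ ε * m) :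
    NearlyFull G (nextRel G A S) B C (c₁ * c₂ / 8 * m) ε := by
  have hε0 := h.ε_pos
  have hq := h.q_pos
  have hm0 := h.m_pos
  have hc : 0 ≤ c₁ * c₂ := by linarith
  set θ := c₁ * c₂ / 2 * (q * m) with hθ
  set Y := {v ∈ B | θ < (#(A.bipartiteBelow S v) : ℝ)}
  have hYB : Y ⊆ B := Finset.filter_subset _ _
  have hlower : m * θ ≤ ∑ v ∈ Y, (#(A.bipartiteBelow S v) : ℝ) := by
    have htotal := hmany.mul_le_card_interedges (by positivity)
    have hsplit := sum_le_sum_filter_lt_add B (fun v => (#(A.bipartiteBelow S v) : ℝ))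
      (θ := θ) (by positivity)
    rw [← card_interedges_eq_sum_bipartiteBelow, h.card_mid] at hsplit
    have hdouble : c₂ * m * (c₁ * q * m) = 2 * (m * θ) := by rw [hθ]; ring
    linarith
  have hupper : ∑ v ∈ Y, (#(A.bipartiteBelow S v) : ℝ) ≤ 2 * q * (m * (#Y + ε * m + 1)) := by
    rw [← card_interedges_eq_sum_bipartiteBelow, ← h.card_left]
    refine (card_interedges_mono subset_rfl subset_rfl hS).trans ?_
    rw [h.card_left]
    nth_rw 1 [← h.card_left]
    exact h.balanced.card_edgesBetween_le hq.le (by positivity) h.mul_le_card_left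
      h.mul_le_card_mid hYB
  have hYcard : c₁ * c₂ / 4 * m ≤ #Y + ε * m + 1 := by
    refine le_of_mul_le_mul_left ?_ (show 0 < 2 * q * m by positivity)
    calc 2 * q * m * (c₁ * c₂ / 4 * m) = m * θ := by rw [hθ]; ring
      _ ≤ 2 * q * (m * (#Y + ε * m + 1)) := hlower.trans hupper
      _ = 2 * q * m * (#Y + ε * m + 1) := by ring
  obtain ⟨X, hXB, hX, hfull⟩ := h.nearlyFull_nextRel hS hYB fun y hy => by
    refine le_trans ?_ (Finset.mem_filter.1 hy).2.le
    rw [hθ, mul_assoc]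
    gcongr
    linarith
  exact ⟨X, hXB, by nlinarith, hfull⟩

end SpreadTriple

lemma card_edgesBetween_le_card_interedges_add (hS : S ≤ G.Adj) (hZ : Z ⊆ B)
    (hfull : ∀ x ∈ X, (1 - ε) * #(nbhdIn G x B) ≤ #(B.bipartiteAbove S x)) :
    (#(edgesBetween G X Z) : ℝ) ≤ #(Rel.interedges S X Z) + ε * #(edgesBetween G X B) := by
  simp only [edgesBetween, SimpleGraph.interedges, card_interedges_eq_sum_bipartiteAbove]
  rw [Finset.mul_sum, ← Finset.sum_add_distrib]
  refine Finset.sum_le_sum fun x hx => ?_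
  have hunion : Z.bipartiteAbove G.Adj x ∪ B.bipartiteAbove S x ⊆ B.bipartiteAbove G.Adj x := by
    simp only [Finset.subset_iff, Finset.mem_union, Finset.mem_bipartiteAbove]
    rintro w (hw | hw)
    exacts [⟨hZ hw.1, hw.2⟩, ⟨hw.1, hS x w hw.2⟩]
  have hinter : Z.bipartiteAbove G.Adj x ∩ B.bipartiteAbove S x ⊆ Z.bipartiteAbove S x := by
    simp only [Finset.subset_iff, Finset.mem_inter, Finset.mem_bipartiteAbove]
    exact fun w hw => ⟨hw.1.1, hw.2.2⟩
  have hcard : (#(Z.bipartiteAbove G.Adj x) : ℝ) + #(B.bipartiteAbove S x) ≤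
      #(B.bipartiteAbove G.Adj x) + #(Z.bipartiteAbove S x) := by
    rw [← Nat.cast_add, ← Finset.card_union_add_card_inter]
    exact_mod_cast add_le_add (Finset.card_le_card hunion) (Finset.card_le_card hinter)
  have hx : (1 - ε) * #(B.bipartiteAbove G.Adj x) ≤ #(B.bipartiteAbove S x) := hfull x hx
  linarith

lemma IsBalanced.card_filter_card_bipartiteBelow_lt_le (hbal : IsBalanced G A B q (ε * #B))
    (hS : S ≤ G.Adj) (hq : 0 < q) (hε₀ : 0 < ε) (hε : ε ≤ 1) (hB : 0 < #B) (hXA : X ⊆ A)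
    (hX : ε * #B ≤ #X)
    (hfull : ∀ x ∈ X, (1 - ε) * #(nbhdIn G x B) ≤ #(B.bipartiteAbove S x)) :
    (#{y ∈ B | (#(X.bipartiteBelow S y) : ℝ) < #X * q / 4} : ℝ) ≤ 8 * ε * #B := by
  set Z := {y ∈ B | (#(X.bipartiteBelow S y) : ℝ) < #X * q / 4} with hZ
  have hZB : Z ⊆ B := Finset.filter_subset _ _
  have hB0 : (0 : ℝ) < #B := by exact_mod_cast hB
  have hX0 : (0 : ℝ) < #X := (show 0 < ε * #B by positivity).trans_le hX
  rcases le_total (ε * #B) #Z with hlarge | hsmall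
  · have hlower := (hbal X hXA Z hZB hX hlarge).1
    have hupper := (hbal X hXA B subset_rfl hX (mul_le_of_le_one_left hB0.le hε)).2
    have hpoor : (#(Rel.interedges S X Z) : ℝ) ≤ #Z * (#X * q / 4) := by
      rw [card_interedges_eq_sum_bipartiteBelow, ← nsmul_eq_mul]
      exact Finset.sum_le_card_nsmul _ _ _ fun y hy => (Finset.mem_filter.1 hy).2.le
    have hsum := card_edgesBetween_le_card_interedges_add hS hZB hfull
    have hmissing : ε * #(edgesBetween G X B) ≤ ε * (2 * q * (#X * #B)) := by gcongr
    refine le_of_mul_le_mul_left ?_ (show 0 < q * #X / 4 by positivity)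
    linarith
  · nlinarith

lemma SpreadTriple.nearlyFull_of_nearlyFull (h : SpreadTriple G A B C q ε m) (hS : S ≤ G.Adj)
    (hF : NearlyFull G S A B (c * m) ε) (hc : 8 * ε ≤ c) :
    NearlyFull G (nextRel G A S) B C ((1 - 10 * ε) * m) ε := by
  have hε := h.ε_pos
  have hq := h.q_pos
  have hm := h.m_pos
  have hm' := h.card_mid
  obtain ⟨X, hXA, hX, hfull⟩ := hF
  have hXm : 8 * ε * m ≤ #X := le_trans (by gcongr) hX
  set Z := {y ∈ B | (#(X.bipartiteBelow S y) : ℝ) < #X * q / 4}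
  have hZcard : (#Z : ℝ) ≤ 8 * ε * m := by
    rw [← hm']
    refine IsBalanced.card_filter_card_bipartiteBelow_lt_le (hm' ▸ h.balanced) hS hq hε
      h.ε_lt_one.le (by exact_mod_cast hm' ▸ hm) hXA ?_ hfull
    rw [hm']
    nlinarith
  obtain ⟨X', hX'B, hX', hfull'⟩ := h.nearlyFull_nextRel hS (Y := B \ Z) Finset.sdiff_subset
    fun y hy => by
      obtain ⟨hyB, hyZ⟩ := Finset.mem_sdiff.1 hy
      calc 2 * ε * q * m ≤ #X * q / 4 := by nlinarith
        _ ≤ #(X.bipartiteBelow S y) :=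
            not_lt.1 fun hlt => hyZ (Finset.mem_filter.2 ⟨hyB, hlt⟩)
        _ ≤ #(A.bipartiteBelow S y) :=
            Nat.cast_le.2 (Finset.card_le_card (Finset.filter_subset_filter _ hXA))
  have hsdiff : (#B : ℝ) ≤ #(B \ Z) + #Z := by
    exact_mod_cast Finset.card_le_card_sdiff_add_card
  exact ⟨X', hX'B, by linarith, hfull'⟩

lemma NearlyFull.mul_card_edgesBetween_le (hF : NearlyFull G S A B (c * #A) ε)
    (hreg : IsRegular G ε A B) (hε : ε ≤ 1) (hc : ε ≤ c) :
    (1 - ε) ^ 2 * c * #(edgesBetween G A B) ≤ #(Rel.interedges S A B) := by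
  obtain ⟨X, hXA, hX, hfull⟩ := hF
  have hd := density_nonneg G A B
  have hdens : (1 - ε) * density G A B ≤ density G X B := by
    have := (abs_le.1 (hreg X hXA B subset_rfl (by nlinarith)
      (mul_le_of_le_one_left (Nat.cast_nonneg _) hε))).1
    linarith
  calc (1 - ε) ^ 2 * c * #(edgesBetween G A B)
      = (1 - ε) * ((1 - ε) * density G A B * (c * #A * #B)) := by
        rw [card_edgesBetween_eq_density_mul]
        ring
    _ ≤ (1 - ε) * ((1 - ε) * density G A B * (#X * #B)) := by gcongr
    _ ≤ (1 - ε) * (density G X B * (#X * #B)) := by gcongr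
    _ = (1 - ε) * #(edgesBetween G X B) := by rw [card_edgesBetween_eq_density_mul]
    _ ≤ #(Rel.interedges S X B) := by
        simp only [edgesBetween, SimpleGraph.interedges, card_interedges_eq_sum_bipartiteAbove]
        rw [Finset.mul_sum]
        exact Finset.sum_le_sum hfull
    _ ≤ #(Rel.interedges S A B) := card_interedges_mono hXA subset_rfl le_rfl

theorem nearlyFull_reach {V : ℕ → Finset W} {e : W × W} {l : ℕ} (he : G.Adj e.1 e.2)
    (hT : ∀ i < l, SpreadTriple G (V i) (V (i + 1)) (V (i + 2)) q ε m)
    (hc₁ : 0 ≤ c₁) (hε' : 18 * ε ≤ 1) (hε : 64 * ε ≤ c₁ * c₂) (hm : 1 ≤ ε * m) {j : ℕ}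
    (hj : j + 2 ≤ l)
    (hmany : ManyOut (reach G V e j) (V j) (V (j + 1)) (c₂ * m) (c₁ * q * m)) :
    NearlyFull G (reach G V e l) (V l) (V (l + 1)) ((1 - 10 * ε) * m) ε := by
  have hε0 := (hT j (by omega)).ε_pos
  have hnext := (hT j (by omega)).nearlyFull_of_manyOut (reach_le_adj he j) hc₁ hmany
    (by linarith) hm
  induction l, hj using Nat.le_induction with
  | base =>
    exact (hT (j + 1) (by omega)).nearlyFull_of_nearlyFull (reach_le_adj he (j + 1)) hnext
      (by linarith)
  | succ l _ ih =>
    exact (hT l (by omega)).nearlyFull_of_nearlyFull (reach_le_adj he l)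
      (ih fun i hi => hT i (by omega)) (by linarith)

end Spreading

/-! ### The blow-up inside the random graph -/

section BlowUp

variable {k n₀ : ℕ} {V : Fin (k + 1) → Finset W} {q ε : ℝ}

/-- The vertex sets of a blow-up, continued by empty sets so that indices need not be bounded. -/
def extendSets (V : Fin (k + 1) → Finset W) (i : ℕ) : Finset W :=
  if h : i < k + 1 then V ⟨i, h⟩ else ∅

lemma extendSets_of_lt {i : ℕ} (h : i < k + 1) : extendSets V i = V ⟨i, h⟩ := dif_pos h

lemma pathSquare_adj_succ {i : ℕ} (hi : i + 1 ≤ k) :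
    (pathSquare k).Adj ⟨i, by omega⟩ ⟨i + 1, by omega⟩ :=
  ⟨by simp, by simp only; omega, by simp only; omega⟩

lemma IsTildeBlowUp.closesTriangles (h : IsTildeBlowUp k G V n₀ q ε) (hd : d ≤ (1 - ε) * n₀ * q ^ 2)
    {i : ℕ} (hi : i + 2 ≤ k) :
    ClosesTriangles G (extendSets V i) (extendSets V (i + 1)) (extendSets V (i + 2)) d := by
  rw [extendSets_of_lt (by omega), extendSets_of_lt (by omega), extendSets_of_lt (by omega)]
  exact fun u hu v hv huv => hd.trans (h.triangles i (by omega) u hu v hv huv)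

lemma IsTildeBlowUp.spreadTriple (h : IsTildeBlowUp k G V n₀ q ε) (hn₀ : 0 < n₀) (hq : 0 < q)
    (hε₀ : 0 < ε) (hε : ε ≤ 1 / 12) {i : ℕ} (hi : i + 2 ≤ k) :
    SpreadTriple G (extendSets V i) (extendSets V (i + 1)) (extendSets V (i + 2)) q ε n₀ := by
  rw [extendSets_of_lt (by omega), extendSets_of_lt (by omega), extendSets_of_lt (by omega)]
  have hadj := pathSquare_adj_succ (k := k) (i := i) (by omega)
  have hcard : ∀ j, (#(V j) : ℝ) = n₀ := fun j => by rw [h.card_eq j]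
  exact {
    balanced := (h.regular _ _ hadj).isBalanced hq.le hε (hcard _) (hcard _)
      (h.density_ge _ _ hadj) (h.density_le _ _ hadj)
    card_left := hcard _
    card_mid := hcard _
    lowerRegular := h.lowerRegular i (by omega)
    m_pos := by exact_mod_cast hn₀
    q_pos := hq
    ε_pos := hε₀
    ε_lt_one := by linarith }

end BlowUp

lemma nearlyFull_reach_of_isTildeBlowUp [Fintype W] {k n₀ : ℕ} {V : Fin (k + 4 + 1) → Finset W}
    {α ε μ : ℝ} (hα : 0 < α) (h : IsTildeBlowUp (k + 4) G V n₀ (α * p) ε)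
    (hr : ExpansionRegime k (Fintype.card W) p D (α ^ 2 / 2 * p ^ 2 * n₀) μ)
    (hG : EdgeBounded G p D) (hε : 18 * ε ≤ 1) (hεα : 184320 * ε ≤ α ^ 3) (hm : 1 ≤ ε * n₀)
    {e : W × W} (he : e ∈ edgesBetween G (extendSets V 0) (extendSets V 1)) :
    NearlyFull G (reach G (extendSets V) e (k + 3)) (extendSets V (k + 3)) (extendSets V (k + 4))
      ((1 - 10 * ε) * n₀) ε := by
  have hp := hr.p_pos
  have hε₀ : 0 < ε := pos_of_mul_pos_left (zero_lt_one.trans_le hm) (Nat.cast_nonneg _)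
  have hn₀ : (0 : ℝ) < n₀ := pos_of_mul_pos_right (zero_lt_one.trans_le hm) hε₀.le
  have hd : α ^ 2 / 2 * p ^ 2 * n₀ ≤ (1 - ε) * n₀ * (α * p) ^ 2 := by
    have : 0 ≤ n₀ * (α * p) ^ 2 := by positivity
    nlinarith
  have hdisj : ∀ i j, i < j → j ≤ k + 2 → Disjoint (extendSets V i) (extendSets V j) := by
    intro i j hij hj
    rw [extendSets_of_lt (by omega), extendSets_of_lt (by omega)]
    exact h.disjoint _ _ (by simp; omega)
  obtain ⟨j, hj, hmany⟩ := exists_manyOut_reach hr hG he hdisj fun i hi =>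
    h.closesTriangles hd (by omega)
  have hleft : α ^ 2 / 2 * p ^ 2 * n₀ / (120 * p ^ 2) = α ^ 2 / 240 * n₀ := by
    field_simp
    norm_num
  have hdeg : α ^ 2 / 2 * p ^ 2 * n₀ / (6 * p) = α / 12 * (α * p) * n₀ := by
    field_simp
    norm_num
  rw [hleft, hdeg] at hmany
  exact nearlyFull_reach (mem_edgesBetween.1 he).2.2
    (fun i hi => h.spreadTriple (by exact_mod_cast hn₀) (by positivity) hε₀ (by linarith)
      (by omega))
    (by positivity) hε (by linarith) hm (by omega) hmany

theorem exists_expands [Fintype W] {k n₀ : ℕ} {V : Fin (k + 4 + 1) → Finset W} {α ε μ : ℝ}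
    (hα : 0 < α) (h : IsTildeBlowUp (k + 4) G V n₀ (α * p) ε)
    (hr : ExpansionRegime k (Fintype.card W) p D (α ^ 2 / 2 * p ^ 2 * n₀) μ)
    (hG : EdgeBounded G p D) (hε : 18 * ε ≤ 1) (hεα : 184320 * ε ≤ α ^ 3) (hm : 1 ≤ ε * n₀)
    {e : W × W} (he : e ∈ edgesBetween G (V 0) (V 1)) :
    ∃ E' ⊆ edgesBetween G (V (Fin.last (k + 3)).castSucc) (V (Fin.last (k + 4))),
      (1 - 12 * ε) * #(edgesBetween G (V (Fin.last (k + 3)).castSucc) (V (Fin.last (k + 4)))) ≤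
        #E' ∧ Expands G V e E' := by
  have hV : ∀ i : Fin (k + 4 + 1), extendSets V i = V i := fun i => extendSets_of_lt i.2
  have hVl : extendSets V (k + 3) = V (Fin.last (k + 3)).castSucc := hV (Fin.last (k + 3)).castSucc
  have hVr : extendSets V (k + 4) = V (Fin.last (k + 4)) := hV (Fin.last (k + 4))
  have he' : e ∈ edgesBetween G (extendSets V 0) (extendSets V 1) := by
    rwa [show extendSets V 0 = V 0 from hV 0, show extendSets V 1 = V 1 from hV 1]
  have hε₀ : 0 < ε := pos_of_mul_pos_left (zero_lt_one.trans_le hm) (Nat.cast_nonneg _)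
  have hfull := nearlyFull_reach_of_isTildeBlowUp hα h hr hG hε hεα hm he'
  have hreg : IsRegular G ε (V (Fin.last (k + 3)).castSucc) (V (Fin.last (k + 4))) :=
    h.regular _ _ (pathSquare_adj_succ (i := k + 3) le_rfl)
  rw [← hVl, ← hVr] at hreg ⊢
  refine ⟨Rel.interedges (reach G (extendSets V) e (k + 3)) (extendSets V (k + 3))
    (extendSets V (k + 4)), Finset.monotone_filter_right _ fun e' _ =>
      reach_le_adj (mem_edgesBetween.1 he).2.2 (k + 3) e'.1 e'.2, ?_,
    expands_of_reach (k := k + 3) hV h.disjoint he' subset_rfl⟩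
  have hcard : (#(extendSets V (k + 3)) : ℝ) = n₀ := by rw [hVl, h.card_eq]
  rw [← hcard] at hfull
  refine le_trans ?_ (hfull.mul_card_edgesBetween_le hreg (by linarith) (by linarith))
  gcongr
  nlinarith [pow_pos hε₀ 2]

section Asymptotics

variable {γ δ μ : ℝ} {k : ℕ}

lemma eventually_le_mul_rpow (C : ℝ) (hμ : 0 < μ) (hδ : 0 < δ) :
    ∀ᶠ n : ℕ in atTop, C ≤ μ * (n : ℝ) ^ δ :=
  have hrpow := (tendsto_rpow_atTop hδ).comp tendsto_natCast_atTop_atTop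
  (hrpow.const_mul_atTop hμ).eventually_ge_atTop C

lemma rpow_mul_rpow_pow_le {x t : ℝ} (hx : 1 ≤ x) (ht : x ^ (-1 / 2 + γ / 2) ≤ t)
    (hδ : 3 + (3 * k + 5) * δ ≤ (k + 1) * γ) :
    x ^ 3 * (x ^ δ) ^ (3 * k + 5) ≤ (t ^ 2 * x) ^ (k + 1) := by
  have hx0 : 0 < x := zero_lt_one.trans_le hx
  have hγ : x ^ γ ≤ t ^ 2 * x := by
    calc x ^ γ = (x ^ (-1 / 2 + γ / 2)) ^ 2 * x := by
          rw [← Real.rpow_mul_natCast hx0.le, ← Real.rpow_add_one hx0.ne']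
          congr 1
          push_cast
          ring
      _ ≤ t ^ 2 * x := by gcongr
  calc x ^ 3 * (x ^ δ) ^ (3 * k + 5) = x ^ (3 + δ * (3 * k + 5 : ℕ)) := by
        rw [Real.rpow_add hx0, Real.rpow_mul_natCast hx0.le, ← Real.rpow_natCast x 3]
        norm_num
    _ ≤ x ^ (γ * (k + 1 : ℕ)) := by
        gcongr
        push_cast
        linarith
    _ = (x ^ γ) ^ (k + 1) := Real.rpow_mul_natCast hx0.le _ _
    _ ≤ (t ^ 2 * x) ^ (k + 1) := by gcongr

lemma eventually_expansionRegime {p : ℕ → unitInterval}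
    (hp : ∀ᶠ n : ℕ in atTop, (n : ℝ) ^ (-1 / 2 + γ / 2 : ℝ) ≤ p n) (hμ : 0 < μ) (hμ₁ : μ ≤ 1)
    (hδ : 0 < δ) (hδγ : 3 + (3 * k + 5) * δ ≤ (k + 1) * γ) :
    ∀ᶠ n : ℕ in atTop, ∀ d : ℝ, μ * ((p n : ℝ) ^ 2 * n) ≤ d →
      ExpansionRegime k n (p n) ((n : ℝ) ^ δ) d μ := by
  filter_upwards [hp, eventually_le_mul_rpow 432 (pow_pos hμ 2) hδ, eventually_ge_atTop 1]
    with n hpn hlarge hn d hd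
  have hn₁ : (1 : ℝ) ≤ n := by exact_mod_cast hn
  exact {
    one_le_N := hn₁
    p_pos := (Real.rpow_pos_of_pos (zero_lt_one.trans_le hn₁) _).trans_le hpn
    p_le_one := (p n).2.2
    μ_pos := hμ
    μ_le_one := hμ₁
    le_sq_mul := hlarge
    mul_le := hd
    pow_mul_pow_le := rpow_mul_rpow_pow_le hn₁ hpn hδγ }

end Asymptotics
end PathExpansion

theorem mainTheorem3_general (α ρ : ℝ) (hα : 0 < α) (hρ : ρ < 1) :
    ∃ ε₀ : ℝ, 0 < ε₀ ∧ ∀ ε : ℝ, 0 < ε → ε ≤ ε₀ →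
      ∀ (η γ : ℝ) (k : ℕ), 0 < η → 3 < ((k : ℝ) + 1) * γ →
      ∀ p : ℕ → unitInterval,
      (∀ᶠ n : ℕ in Filter.atTop, (n : ℝ) ^ (-1 / 2 + γ / 2 : ℝ) ≤ (p n : ℝ)) →
      Filter.Tendsto
        (fun n : ℕ => SimpleGraph.binomialRandom (Fin n) (p n)
          {H : SimpleGraph (Fin n) |
            ∀ G : SimpleGraph (Fin n), G ≤ H →
            ∀ (n₀ : ℕ) (V : Fin (k + 4 + 1) → Finset (Fin n)), η * (n : ℝ) ≤ (n₀ : ℝ) →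
              PathExpansion.IsTildeBlowUp (k + 4) G V n₀ (α * (p n : ℝ)) ε →
              ∀ e ∈ PathExpansion.edgesBetween G (V 0) (V 1),
                ∃ E' ⊆ PathExpansion.edgesBetween G
                    (V (Fin.last (k + 3)).castSucc) (V (Fin.last (k + 4))),
                  ρ * ((PathExpansion.edgesBetween G
                    (V (Fin.last (k + 3)).castSucc) (V (Fin.last (k + 4)))).card : ℝ)
                      ≤ (E'.card : ℝ) ∧
                  PathExpansion.Expands G V e E'})
        Filter.atTop (nhds 1) := by
  refine ⟨min (1 / 18) (min (α ^ 3 / 184320) ((1 - ρ) / 12)), by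
    have := sub_pos.2 hρ
    positivity, fun ε hε hε₀ η γ k hη hk p hp => ?_⟩
  simp only [le_min_iff] at hε₀
  obtain ⟨hε₁, hε₂, hε₃⟩ := hε₀
  set δ : ℝ := ((k + 1) * γ - 3) / (3 * k + 5) with hδ_def
  have hδ : 0 < δ := div_pos (by linarith) (by positivity)
  have hδγ : 3 + (3 * k + 5) * δ ≤ (k + 1) * γ := by
    rw [hδ_def, mul_div_cancel₀ _ (by positivity)]
    linarith
  refine PathExpansion.tendsto_binomialRandom_of_edgeBounded p hδ ?_
  filter_upwards [PathExpansion.eventually_expansionRegime (μ := min 1 (α ^ 2 * η / 2)) hp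
      (by positivity) (min_le_left _ _) hδ hδγ,
    PathExpansion.eventually_le_mul_rpow 1 (mul_pos hε hη) one_pos]
    with n hregime hlarge H hH G hGH n₀ V hn₀ hblow e he
  rw [Real.rpow_one] at hlarge
  have hr := hregime (α ^ 2 / 2 * (p n : ℝ) ^ 2 * n₀) <| by
    calc min 1 (α ^ 2 * η / 2) * ((p n : ℝ) ^ 2 * n)
        ≤ α ^ 2 * η / 2 * ((p n : ℝ) ^ 2 * n) := by gcongr; exact min_le_right _ _
      _ = α ^ 2 / 2 * (p n : ℝ) ^ 2 * (η * n) := by ring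
      _ ≤ α ^ 2 / 2 * (p n : ℝ) ^ 2 * n₀ := by gcongr
  obtain ⟨E', hE', hcard, hexp⟩ := PathExpansion.exists_expands hα hblow
    (by rwa [Fintype.card_fin]) (hH.mono hGH) (by linarith) (by linarith)
    (hlarge.trans (by rw [mul_assoc]; gcongr)) he
  exact ⟨E', hE', (mul_le_mul_of_nonneg_right (by linarith) (Nat.cast_nonneg _)).trans hcard, hexp⟩

theorem mainTheorem3 (α : ℝ) (hα : 0 < α) :
    ∃ ε₀ : ℝ, 0 < ε₀ ∧ ∀ ε : ℝ, 0 < ε → ε ≤ ε₀ →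
      ∀ (η γ : ℝ) (k : ℕ), 0 < η → 0 < γ → 3 / γ ≤ (k : ℝ) →
      ∀ p : ℕ → unitInterval, (∀ n : ℕ, (p n : ℝ) = (n : ℝ) ^ (-1 / 2 + γ / 2 : ℝ)) →
      Filter.Tendsto
        (fun n : ℕ => SimpleGraph.binomialRandom (Fin n) (p n)
          {H : SimpleGraph (Fin n) |
            ∀ G : SimpleGraph (Fin n), G ≤ H →
            ∀ (n₀ : ℕ) (V : Fin (k + 4 + 1) → Finset (Fin n)), η * (n : ℝ) ≤ (n₀ : ℝ) →
              PathExpansion.IsTildeBlowUp (k + 4) G V n₀ (α * (p n : ℝ)) ε →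
              ∀ e ∈ PathExpansion.edgesBetween G (V 0) (V 1),
                ∃ E' ⊆ PathExpansion.edgesBetween G
                    (V (Fin.last (k + 3)).castSucc) (V (Fin.last (k + 4))),
                  (0.52 : ℝ) * ((PathExpansion.edgesBetween G
                    (V (Fin.last (k + 3)).castSucc) (V (Fin.last (k + 4)))).card : ℝ)
                      ≤ (E'.card : ℝ) ∧
                  PathExpansion.Expands G V e E'})
        Filter.atTop (nhds 1) := by
  obtain ⟨ε₀, hε₀, h⟩ := mainTheorem3_general α 0.52 hα (by norm_num)
  refine ⟨ε₀, hε₀, fun ε hε hεle η γ k hη hγ hk p hp => h ε hε hεle η γ k hη ?_ p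
    (Filter.Eventually.of_forall fun n => (hp n).ge)⟩
  linarith [(div_le_iff₀ hγ).1 hk]
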